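/- Let $M$ be a smooth $n$-dimensional manifold and let $V\subset\mathfrak X(M)$ be a completely regular real vector space of smooth vector fields, i.e. for every $p\in M$ evaluation at $p$ is a linear isomorphism $V\to T_pM$. For $S\subset\mathfrak X(M)$ let $\mathcal D_S$ be the $C^\infty(M)$-module generated by $S$, and let $\operatorname{core}(S)$ be the smallest subspace $W\subset V$ with $S\subset\mathcal D_W$. Let $\Gamma\in V$, and put $V_{\Gamma,0}=V$ and $V_{\Gamma,m}=\langle\Gamma\rangle+\operatorname{core}([V_{\Gamma,m-1},V_{\Gamma,m-1}])$ for $m\ge 1$. Assume that $(M,V,\Gamma)$ is distributionally integrable of order $r\geq 1$, i.e. $V_{\Gamma,r-1}$ is the first Abelian space (any two elements commute) in this series. Then $\Gamma$ can be integrated by $r$ quadratures, by iteratively integrating closed 1-forms on leaves, in the following sense. Known functions. Given a set $G$ of real functions, each defined on an open subset of some $\mathbb R^m$, call a function on an open subset of some $\mathbb R^m$ known from $G$ if it is obtained from functions in $G$, coordinate functions and constants by finitely many operations of restriction to open subsets, sum, product, reciprocal of a nowhere vanishing function, substitution, partial differentiation, and elimination (the components of a continuous solution $y=g(x)$ of a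 system $F(x,y)=0$ of $k$ known equations in $k$ unknowns $y$ are known if $\det\partial F/\partial y\ne0$ along it). Quadratures. Let $U\subset\mathbb R^n$ be open, with functions $Q_1,\dots,Q_N$ on $U$ obtained in earlier quadratures, and let $G$ be the current set of functions. The leaves are the common level sets of $Q_1,\dots,Q_N$ in $U$. One quadrature takes * 1-forms $\omega_1,\dots,\omega_d$ on $U$ with components known from $G$, closed on the leaves, i.e. $d\omega_i(u,v)=0$ whenever $dQ_l(u)=dQ_l(v)=0$ for all $l$; * an open set $U'\subset U$ and a family of paths $\gamma_x:[0,1]\to U$ ($x\in U'$), with $(s,x)\mapsto\gamma_x(s)$ known from $G$ on a neighbourhood of $[0,1]\times U'$, such that $\gamma_x$ lies in the leaf of $x$, ends at $x$, and starts at a point that is the same for all $x\in U'$ in the same leaf; and adds to $G$ the function $(x,a)\mapsto\int_{\gamma_x}\sum_{i=1}^d a_i\omega_i$ on $U'\times\mathbb R^d$, a single integral over $s\in[0,1]$ of a known function depending on the finitely many parameters $(x,a)$. The leafwise potentials $Q_{N+i}(x)=\int_{\gamma_x}\omega_i$, $1\le i\le d$, are appended to $Q_1,\dots,Q_N$, and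 it is required that $dQ_1,\dots,dQ_{N+d}$ be linearly independent at every point of $U'$; then $U$ is replaced by $U'$. Conclusion. For every chart $\varphi$ of $M$ and every $p$ in its domain, one can start with $U=\operatorname{im}\varphi$, with no functions $Q$, and with $G$ consisting of the components in the chart $\varphi$ of the vector fields in $V$, and perform exactly $r$ successive quadratures, ending with an open set $U$ and a set $G$, such that there are an open set $U''\subset U$ with $\varphi(p)\in U''$, a number $\varepsilon>0$, and a map $\Phi:(-\varepsilon,\varepsilon)\times U''\to\operatorname{im}\varphi$ whose components are known from the final $G$ and which is the local flow of $\Gamma$ in the chart: $\Phi(0,x)=x$, and $t\mapsto\varphi^{-1}(\Phi(t,x))$ is an integral curve of $\Gamma$ for every $x\in U''$. -/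

import Mathlib

open Set
open scoped Manifold ContDiff

noncomputable section

namespace DistributionalIntegrability

/-! ### Completely regular spaces of vector fields and the series `V_{Γ,m}`

Manifolds are smooth `n`-manifolds modelled on `ℝⁿ = (Fin n → ℝ)`. -/

section VectorFields

variable {n : ℕ} {M : Type*} [TopologicalSpace M] [ChartedSpace (Fin n → ℝ) M]

/-- `X` is a smooth vector field. -/
def IsSmoothField [IsManifold 𝓘(ℝ, Fin n → ℝ) ∞ M]
    (X : (x : M) → TangentSpace 𝓘(ℝ, Fin n → ℝ) x) : Prop :=
  ContMDiff 𝓘(ℝ, Fin n → ℝ) 𝓘(ℝ, Fin n → ℝ).tangent ∞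
    (fun x => (⟨x, X x⟩ : TangentBundle 𝓘(ℝ, Fin n → ℝ) M))

/-- A real vector space `V` of smooth vector fields is completely regular if, at each point `p`,
evaluation at `p` is an isomorphism of `V` onto the whole tangent space at `p`. -/
structure IsCompletelyRegular [IsManifold 𝓘(ℝ, Fin n → ℝ) ∞ M]
    (V : Submodule ℝ ((x : M) → TangentSpace 𝓘(ℝ, Fin n → ℝ) x)) : Prop where
  smooth : ∀ X ∈ V, IsSmoothField X
  bijective_eval : ∀ p : M, Function.Bijective
    (fun X : V => (X : (x : M) → TangentSpace 𝓘(ℝ, Fin n → ℝ) x) p)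

/-- The `C^∞(M)`-module `D_S` generated by a set `S` of vector fields. -/
def distribution (S : Set ((x : M) → TangentSpace 𝓘(ℝ, Fin n → ℝ) x)) :
    Set ((x : M) → TangentSpace 𝓘(ℝ, Fin n → ℝ) x) :=
  {X | ∃ (k : ℕ) (f : Fin k → C^∞⟮𝓘(ℝ, Fin n → ℝ), M; ℝ⟯)
      (Y : Fin k → (x : M) → TangentSpace 𝓘(ℝ, Fin n → ℝ) x),
      (∀ i, Y i ∈ S) ∧ ∀ x, X x = ∑ i, f i x • Y i x}

/-- The core of `S` in `V`: the smallest subspace `W` of `V` with `S ⊆ D_W`. -/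
def core (V : Submodule ℝ ((x : M) → TangentSpace 𝓘(ℝ, Fin n → ℝ) x))
    (S : Set ((x : M) → TangentSpace 𝓘(ℝ, Fin n → ℝ) x)) :
    Submodule ℝ ((x : M) → TangentSpace 𝓘(ℝ, Fin n → ℝ) x) :=
  sInf {W | W ≤ V ∧ S ⊆ distribution (W : Set ((x : M) → TangentSpace 𝓘(ℝ, Fin n → ℝ) x))}

/-- The set of Lie brackets of elements of `W`. -/
def brackets (W : Submodule ℝ ((x : M) → TangentSpace 𝓘(ℝ, Fin n → ℝ) x)) :
    Set ((x : M) → TangentSpace 𝓘(ℝ, Fin n → ℝ) x) :=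
  {Z | ∃ X ∈ W, ∃ Y ∈ W, Z = VectorField.mlieBracket 𝓘(ℝ, Fin n → ℝ) X Y}

/-- `V_{Γ,0} = V` and `V_{Γ,m+1} = ⟨Γ⟩ + core [V_{Γ,m}, V_{Γ,m}]`. -/
def series (V : Submodule ℝ ((x : M) → TangentSpace 𝓘(ℝ, Fin n → ℝ) x))
    (Γ : (x : M) → TangentSpace 𝓘(ℝ, Fin n → ℝ) x) :
    ℕ → Submodule ℝ ((x : M) → TangentSpace 𝓘(ℝ, Fin n → ℝ) x)
  | 0 => V
  | m + 1 => Submodule.span ℝ {Γ} ⊔ core V (brackets (series V Γ m))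

/-- Any two elements of `W` commute. -/
def IsAbelianSpace (W : Submodule ℝ ((x : M) → TangentSpace 𝓘(ℝ, Fin n → ℝ) x)) : Prop :=
  ∀ X ∈ W, ∀ Y ∈ W, ∀ x : M, VectorField.mlieBracket 𝓘(ℝ, Fin n → ℝ) X Y x = 0

/-- `(M, V, Γ)` is distributionally integrable of order `r`: `r = k + 1`, where `V_{Γ,k}` is the
first Abelian term of the series. -/
def IsDistributionallyIntegrable
    (V : Submodule ℝ ((x : M) → TangentSpace 𝓘(ℝ, Fin n → ℝ) x))
    (Γ : (x : M) → TangentSpace 𝓘(ℝ, Fin n → ℝ) x) (r : ℕ) : Prop :=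
  ∃ k : ℕ, r = k + 1 ∧ IsAbelianSpace (series V Γ k) ∧ ∀ j < k, ¬ IsAbelianSpace (series V Γ j)

end VectorFields

/-! ### Known functions -/

/-- A class of real functions of finitely many real variables. `G m U f` says that the function
`f` of `m` variables, considered on the domain `U`, belongs to the class. -/
abbrev FunClass : Type :=
  (m : ℕ) → Set (Fin m → ℝ) → ((Fin m → ℝ) → ℝ) → Prop

/-- The class `G` with one more function, `f` on `U`, added. -/
inductive FunClass.adjoin (G : FunClass) (m : ℕ) (U : Set (Fin m → ℝ)) (f : (Fin m → ℝ) → ℝ) :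
    FunClass
  | old {m' : ℕ} {U' : Set (Fin m' → ℝ)} {f' : (Fin m' → ℝ) → ℝ} (h : G m' U' f') :
      FunClass.adjoin G m U f m' U' f'
  | new : FunClass.adjoin G m U f m U f

/-- `Known G m U f`: on the open set `U ⊆ ℝᵐ` the function `f` is obtained from functions in `G`
and the coordinate functions and constants by finitely many operations of the following kinds:
restriction, sum, product, reciprocal, substitution, partial differentiation, and elimination.
Elimination means that, if `F_1, …, F_k` are known functions of `(x, y) ∈ ℝᵐ × ℝᵏ` and `y = g x` is
a continuous solution of `F (x, y) = 0` along which the Jacobian determinant of `F` with respect to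
`y` does not vanish, then the components of `g` are known. There is no integration. -/
inductive Known (G : FunClass) : FunClass
  | gen {m : ℕ} {U : Set (Fin m → ℝ)} {f : (Fin m → ℝ) → ℝ} (h : G m U f) : Known G m U f
  | const {m : ℕ} {U : Set (Fin m → ℝ)} (hU : IsOpen U) (c : ℝ) : Known G m U (fun _ => c)
  | coord {m : ℕ} {U : Set (Fin m → ℝ)} (hU : IsOpen U) (i : Fin m) : Known G m U (fun x => x i)
  | restrict {m : ℕ} {U U' : Set (Fin m → ℝ)} {f f' : (Fin m → ℝ) → ℝ} (h : Known G m U f)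
      (hU' : IsOpen U') (hsub : U' ⊆ U) (heq : EqOn f' f U') : Known G m U' f'
  | add {m : ℕ} {U : Set (Fin m → ℝ)} {f g : (Fin m → ℝ) → ℝ}
      (hf : Known G m U f) (hg : Known G m U g) : Known G m U (fun x => f x + g x)
  | mul {m : ℕ} {U : Set (Fin m → ℝ)} {f g : (Fin m → ℝ) → ℝ}
      (hf : Known G m U f) (hg : Known G m U g) : Known G m U (fun x => f x * g x)
  | inv {m : ℕ} {U : Set (Fin m → ℝ)} {f : (Fin m → ℝ) → ℝ}
      (hf : Known G m U f) (hne : ∀ x ∈ U, f x ≠ 0) : Known G m U (fun x => (f x)⁻¹)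
  | comp {m k : ℕ} {U : Set (Fin m → ℝ)} {W : Set (Fin k → ℝ)} {f : (Fin k → ℝ) → ℝ}
      {g : (Fin m → ℝ) → Fin k → ℝ} (hU : IsOpen U) (hf : Known G k W f)
      (hg : ∀ i, Known G m U (fun x => g x i)) (hmaps : MapsTo g U W) :
      Known G m U (fun x => f (g x))
  | partialDeriv {m : ℕ} {U : Set (Fin m → ℝ)} {f : (Fin m → ℝ) → ℝ}
      (hf : Known G m U f) (i : Fin m) : Known G m U (fun x => fderiv ℝ f x (Pi.single i 1))
  | elim {m k : ℕ} {W : Set (Fin (m + k) → ℝ)} {F : Fin k → (Fin (m + k) → ℝ) → ℝ}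
      {U : Set (Fin m → ℝ)} {g : (Fin m → ℝ) → Fin k → ℝ}
      (hF : ∀ i, Known G (m + k) W (F i)) (hU : IsOpen U) (hg : ContinuousOn g U)
      (hmem : ∀ x ∈ U, Fin.append x (g x) ∈ W)
      (hzero : ∀ x ∈ U, ∀ i, F i (Fin.append x (g x)) = 0)
      (hdet : ∀ x ∈ U, (Matrix.of fun i j =>
        fderiv ℝ (F i) (Fin.append x (g x)) (Pi.single (Fin.natAdd m j) 1)).det ≠ 0)
      (j : Fin k) : Known G m U (fun x => g x j)

/-! ### Quadratures -/

/-- A 1-form on (an open set of) `ℝⁿ`, given by its components. -/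
abbrev OneForm (n : ℕ) : Type := (Fin n → ℝ) → Fin n → ℝ

/-- The line integral `∫_{γ_x} η` of the 1-form `η` along the path `γ_x : s ↦ γ (s, x)`,
`0 ≤ s ≤ 1`. -/
def lineIntegral {n : ℕ} (γ : (Fin (n + 1) → ℝ) → Fin n → ℝ) (η : OneForm n) (x : Fin n → ℝ) : ℝ :=
  ∫ s in (0 : ℝ)..1,
    ∑ k, η (γ (Fin.cons s x)) k * deriv (fun τ : ℝ => γ (Fin.cons τ x) k) s

/-- `dη` vanishes on the tangent spaces of the common level sets (leaves) of the functions `Q i`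
in `U`. -/
def IsLeafwiseClosedOn {n N : ℕ} (Q : Fin N → (Fin n → ℝ) → ℝ) (U : Set (Fin n → ℝ))
    (η : OneForm n) : Prop :=
  ∀ x ∈ U, ∀ u v : Fin n → ℝ,
    (∀ i, fderiv ℝ (Q i) x u = 0) → (∀ i, fderiv ℝ (Q i) x v = 0) →
      ∑ k, (fderiv ℝ (fun y => η y k) x u * v k - fderiv ℝ (fun y => η y k) x v * u k) = 0

/-- A known family of paths in the leaves of the functions `Q i` in `U`: for each `x ∈ U'` the
path `s ↦ γ (s, x)`, `0 ≤ s ≤ 1`, stays in the leaf of `x`, runs to `x`, and starts at a reference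
point depending only on the leaf of `x`. -/
structure IsLeafwisePathFamily (G : FunClass) {n N : ℕ} (Q : Fin N → (Fin n → ℝ) → ℝ)
    (U U' : Set (Fin n → ℝ)) (γ : (Fin (n + 1) → ℝ) → Fin n → ℝ) : Prop where
  known : ∃ W : Set (Fin (n + 1) → ℝ), IsOpen W ∧
    (∀ x ∈ U', ∀ s ∈ Icc (0 : ℝ) 1, (Fin.cons s x : Fin (n + 1) → ℝ) ∈ W) ∧
    ∀ k, Known G (n + 1) W (fun z => γ z k)
  mem : ∀ x ∈ U', ∀ s ∈ Icc (0 : ℝ) 1, γ (Fin.cons s x) ∈ U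
  mem_leaf : ∀ x ∈ U', ∀ s ∈ Icc (0 : ℝ) 1, ∀ i, Q i (γ (Fin.cons s x)) = Q i x
  target : ∀ x ∈ U', γ (Fin.cons 1 x) = x
  source : ∀ x ∈ U', ∀ x' ∈ U', (∀ i, Q i x = Q i x') → γ (Fin.cons 0 x) = γ (Fin.cons 0 x')

/-- `QuadratureTower G₀ U₀ r N Q U G`: starting from the functions of `G₀` and the open set `U₀`,
`r` successive quadratures have been performed. They produced the functions `Q_1, …, Q_N` on the
open set `U`, and `G` is `G₀` together with the `r` integrals.

One quadrature takes 1-forms `η_1, …, η_d` with known components which are closed on the leaves of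
the functions `Q_1, …, Q_N` obtained before, and a known family of paths `γ_x` in these leaves, and
computes the single integral `∫_{γ_x} (a_1 η_1 + ⋯ + a_d η_d)` of a known function of
`(s, x, a)` over `0 ≤ s ≤ 1`, which depends on the parameters `(x, a) ∈ U' × ℝᵈ`; that is, it
computes the leafwise potentials `q_i x = ∫_{γ_x} η_i`. All the potentials obtained so far are
functionally independent on the new open set `U' ⊆ U`. -/
inductive QuadratureTower {n : ℕ} (G₀ : FunClass) (U₀ : Set (Fin n → ℝ)) :
    ℕ → (N : ℕ) → (Fin N → (Fin n → ℝ) → ℝ) → Set (Fin n → ℝ) → FunClass → Prop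
  | zero (Q : Fin 0 → (Fin n → ℝ) → ℝ) : QuadratureTower G₀ U₀ 0 0 Q U₀ G₀
  | succ {r N : ℕ} {Q : Fin N → (Fin n → ℝ) → ℝ} {U : Set (Fin n → ℝ)} {G : FunClass}
      (prev : QuadratureTower G₀ U₀ r N Q U G)
      (U' : Set (Fin n → ℝ)) (hU' : IsOpen U') (hsub : U' ⊆ U)
      (d : ℕ) (η : Fin d → OneForm n) (γ : (Fin (n + 1) → ℝ) → Fin n → ℝ)
      (hη : ∀ i k, Known G n U (fun y => η i y k))
      (hclosed : ∀ i, IsLeafwiseClosedOn Q U (η i))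
      (hγ : IsLeafwisePathFamily G Q U U' γ)
      (hindep : ∀ x ∈ U', LinearIndependent ℝ (fun i : Fin (N + d) =>
        fderiv ℝ (Fin.append Q (fun j => lineIntegral γ (η j)) i) x)) :
      QuadratureTower G₀ U₀ (r + 1) (N + d)
        (Fin.append Q (fun j => lineIntegral γ (η j))) U'
        (FunClass.adjoin G (n + d) {z | (fun k => z (Fin.castAdd d k)) ∈ U'}
          (fun z => lineIntegral γ (fun y k => ∑ i, z (Fin.natAdd n i) * η i y k)
            (fun k => z (Fin.castAdd d k))))

/-! ### Integrability by quadratures -/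

section Integrability

variable {n : ℕ} {M : Type*} [TopologicalSpace M] [ChartedSpace (Fin n → ℝ) M]

/-- The components, in the chart `φ`, of the vector field `X`. -/
def chartField (φ : OpenPartialHomeomorph M (Fin n → ℝ))
    (X : (x : M) → TangentSpace 𝓘(ℝ, Fin n → ℝ) x) (y : Fin n → ℝ) : Fin n → ℝ :=
  mfderiv 𝓘(ℝ, Fin n → ℝ) 𝓘(ℝ, Fin n → ℝ) φ (φ.symm y) (X (φ.symm y))

/-- The initial data: the components in the chart `φ` of the vector fields in `V`. -/
inductive chartData (φ : OpenPartialHomeomorph M (Fin n → ℝ))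
    (V : Submodule ℝ ((x : M) → TangentSpace 𝓘(ℝ, Fin n → ℝ) x)) : FunClass
  | mk (X : (x : M) → TangentSpace 𝓘(ℝ, Fin n → ℝ) x) (hX : X ∈ V) (i : Fin n) :
      chartData φ V n φ.target (fun y => chartField φ X y i)

/-- `Φ : (t, x) ↦ Φ (t, x)`, on `(-ε, ε) × U`, is the local flow of `Γ` in the chart `φ`. -/
structure IsLocalFlow (φ : OpenPartialHomeomorph M (Fin n → ℝ))
    (Γ : (x : M) → TangentSpace 𝓘(ℝ, Fin n → ℝ) x) (ε : ℝ) (U : Set (Fin n → ℝ))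
    (Φ : (Fin (n + 1) → ℝ) → Fin n → ℝ) : Prop where
  mem_target : ∀ x ∈ U, ∀ t ∈ Ioo (-ε) ε, Φ (Fin.cons t x) ∈ φ.target
  init : ∀ x ∈ U, Φ (Fin.cons 0 x) = x
  isIntegralCurve : ∀ x ∈ U,
    IsMIntegralCurveOn (fun t : ℝ => φ.symm (Φ (Fin.cons t x))) Γ (Ioo (-ε) ε)

/-- `Γ` can be integrated by `r` quadratures (the vector fields in `V` being given): in every chart
and near every point of its domain, `r` successive quadratures can be performed, starting from the
components of the vector fields in `V`, after which the local flow of `Γ` is a known function of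
the time and the initial point, i.e. no further integration is needed. -/
def IsIntegrableByQuadratures (V : Submodule ℝ ((x : M) → TangentSpace 𝓘(ℝ, Fin n → ℝ) x))
    (Γ : (x : M) → TangentSpace 𝓘(ℝ, Fin n → ℝ) x) (r : ℕ) : Prop :=
  ∀ φ ∈ IsManifold.maximalAtlas 𝓘(ℝ, Fin n → ℝ) ∞ M, ∀ p ∈ φ.source,
    ∃ (N : ℕ) (Q : Fin N → (Fin n → ℝ) → ℝ) (U : Set (Fin n → ℝ)) (G : FunClass),
      QuadratureTower (chartData φ V) φ.target r N Q U G ∧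
      ∃ (U' : Set (Fin n → ℝ)) (ε : ℝ) (Φ : (Fin (n + 1) → ℝ) → Fin n → ℝ),
        IsOpen U' ∧ φ p ∈ U' ∧ U' ⊆ U ∧ 0 < ε ∧ IsLocalFlow φ Γ ε U' Φ ∧
        ∀ i, Known G (n + 1) {z | z 0 ∈ Ioo (-ε) ε ∧ Fin.tail z ∈ U'} (fun z => Φ z i)

end Integrability

end DistributionalIntegrability

end

/-! A basis of `V` gives, in a chart, a known frame, in which elements of `V` are the fields with
constant coefficients. Let `A m` be the space of coefficients of the elements of `V_{Γ,0} ∩ ... ∩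
V_{Γ,m}`. Completely regular evaluation makes the core pointwise: if `X ∈ V` agrees at one point
with an element of `S`, then `X ∈ core V S` (`IsCompletelyRegular.mem_core`). Hence at each point
the bracket of two fields from `A m` has the value of a field from `A (m + 1)`.

After `m` quadratures the leaves are spanned by the fields from `A m`. Let `ω` be a form with
constant coefficients in the dual coframe that annihilates `A (m + 1)`. Then `ω(X)` is constant for
every frame field `X`, so `dω(X, Y) = -ω([X, Y]) = 0` for fields `X`, `Y` tangent to the leaves: `ω`
is closed there (`IsKnownFrame.isLeafwiseClosedOn`). Its leafwise potentials, for `ω` ranging over a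
basis of such forms on `A m`, cut the leaves down to those spanned by `A (m + 1)`
(`IsStage.exists_quadrature`). When `V_{Γ,k}` is Abelian, one more step with target `⊥` cuts the
leaves down to points, which makes `k + 1 = r` quadratures.

Since `Γ` is tangent to the leaves at every step before the last integration, it acts on each
potential as a constant. The potentials are finally local coordinates in which `Γ` is a constant
field, and the flow is a translation, transported back by elimination (`IsStage.exists_known_flow`).
-/

namespace DistributionalIntegrability

/-! ### Smooth dependence of integrals on parameters. -/

section ParametricIntegral

universe u

variable {H F : Type u} [NormedAddCommGroup H] [NormedSpace ℝ H]
  [NormedAddCommGroup F] [NormedSpace ℝ F]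

theorem continuousOn_slice {X Y Z : Type*} [TopologicalSpace X] [TopologicalSpace Y]
    [TopologicalSpace Z] {f : X × Y → Z} {W : Set (X × Y)} {s : Set X} {y : Y}
    (hf : ContinuousOn f W) (hW : ∀ t ∈ s, (t, y) ∈ W) :
    ContinuousOn (fun t => f (t, y)) s :=
  hf.comp (by fun_prop) hW

/-- Differentiation under an integral over `[0, 1]` of a `C^1` integrand. -/
theorem hasFDerivAt_integral_zero_one {f : ℝ × H → F} {W : Set (ℝ × H)}
    (hW : IsOpen W) (hf : ContDiffOn ℝ 1 f W) {x₀ : H}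
    (hx₀ : ∀ s ∈ Icc (0 : ℝ) 1, (s, x₀) ∈ W) :
    HasFDerivAt (fun x => ∫ s in (0 : ℝ)..1, f (s, x))
      (∫ s in (0 : ℝ)..1, (fderiv ℝ f (s, x₀)).comp (ContinuousLinearMap.inr ℝ ℝ H)) x₀ := by
  have hf' : ContinuousOn (fderiv ℝ f) W := hf.continuousOn_fderiv_of_isOpen hW le_rfl
  have hcont : ContinuousOn (fun z => (fderiv ℝ f z).comp (ContinuousLinearMap.inr ℝ ℝ H)) W :=
    hf'.clm_comp continuousOn_const
  obtain ⟨C, hC⟩ := isCompact_Icc.exists_bound_of_continuousOn (continuousOn_slice hcont hx₀)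
  -- A bound `C` holds on the compact slice over `x₀`. The weaker bound `C + 1` is an open
  -- condition, so by the tube lemma it persists for all `x` near `x₀`, uniformly in `s`.
  set W' : Set (ℝ × H) :=
    W ∩ (fun z => ‖(fderiv ℝ f z).comp (ContinuousLinearMap.inr ℝ ℝ H)‖) ⁻¹' Iio (C + 1) with hW'
  have hW'o : IsOpen W' := hcont.norm.isOpen_inter_preimage hW isOpen_Iio
  have hsub : Icc (0 : ℝ) 1 ×ˢ {x₀} ⊆ W' := by
    rintro ⟨s, x⟩ ⟨hs, rfl⟩
    exact ⟨hx₀ s hs, (hC s hs).trans_lt (lt_add_one C)⟩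
  obtain ⟨u, v, -, hv, hu1, hv1, huv⟩ := generalized_tube_lemma isCompact_Icc
    isCompact_singleton hW'o hsub
  have hvx : v ∈ nhds x₀ := hv.mem_nhds (hv1 rfl)
  have hmem : ∀ s ∈ Icc (0 : ℝ) 1, ∀ x ∈ v, (s, x) ∈ W' := fun s hs x hx => huv ⟨hu1 hs, hx⟩
  have hIoc : uIoc (0 : ℝ) 1 ⊆ Icc (0 : ℝ) 1 := by
    rw [uIoc_of_le zero_le_one]; exact Ioc_subset_Icc_self
  have hci : ∀ x ∈ v, ContinuousOn (fun s => f (s, x)) (Icc 0 1) := fun x hx =>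
    continuousOn_slice hf.continuousOn fun s hs => (hmem s hs x hx).1
  refine intervalIntegral.hasFDerivAt_integral_of_dominated_of_fderiv_le
    (F' := fun x s => (fderiv ℝ f (s, x)).comp (ContinuousLinearMap.inr ℝ ℝ H))
    (bound := fun _ => C + 1) hvx ?_ ?_ ?_ ?_ ?_ ?_
  · filter_upwards [hvx] with x hx
    exact ((hci x hx).mono hIoc).aestronglyMeasurable measurableSet_uIoc
  · exact ContinuousOn.intervalIntegrable (by
      rw [uIcc_of_le zero_le_one]; exact hci x₀ (hv1 rfl))
  · exact ((continuousOn_slice hcont hx₀).mono hIoc).aestronglyMeasurable measurableSet_uIoc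
  · exact Filter.Eventually.of_forall fun s hs x hx => (hmem s (hIoc hs) x hx).2.le
  · simp
  · refine Filter.Eventually.of_forall fun s hs x hx => ?_
    have h1 : HasFDerivAt f (fderiv ℝ f (s, x)) (s, x) :=
      ((hf.contDiffAt (hW.mem_nhds (hmem s (hIoc hs) x hx).1)).differentiableAt
        one_ne_zero).hasFDerivAt
    exact h1.comp x (hasFDerivAt_prodMk_right s x)

/-- An integral over `[0, 1]` depends smoothly on parameters if the integrand does. -/
theorem contDiffOn_integral_zero_one {f : ℝ × H → F} {W : Set (ℝ × H)} {U : Set H}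
    (hW : IsOpen W) (hU : IsOpen U) (hf : ContDiffOn ℝ ∞ f W)
    (hsub : ∀ x ∈ U, ∀ s ∈ Icc (0 : ℝ) 1, (s, x) ∈ W) :
    ContDiffOn ℝ ∞ (fun x => ∫ s in (0 : ℝ)..1, f (s, x)) U := by
  rw [contDiffOn_infty]
  intro k
  have hd : ∀ {G : Type u} [NormedAddCommGroup G] [NormedSpace ℝ G] {f : ℝ × H → G},
      ContDiffOn ℝ ∞ f W → ∀ x ∈ U, HasFDerivAt (fun x => ∫ s in (0 : ℝ)..1, f (s, x))
      (∫ s in (0 : ℝ)..1, (fderiv ℝ f (s, x)).comp (ContinuousLinearMap.inr ℝ ℝ H)) x :=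
    fun hf x hx => hasFDerivAt_integral_zero_one hW (hf.of_le (by simp)) (hsub x hx)
  -- The derivative is an integral of the same type with values in `H →L[ℝ] F`, so the codomain must
  -- vary in the induction; a common universe for `H` and `F` keeps it in range.
  induction k generalizing F with
  | zero =>
    rw [Nat.cast_zero, contDiffOn_zero]
    exact fun x hx => (hd hf x hx).continuousAt.continuousWithinAt
  | succ k ih =>
    rw [Nat.cast_succ, contDiffOn_succ_iff_fderiv_of_isOpen hU]
    refine ⟨fun x hx => (hd hf x hx).differentiableAt.differentiableWithinAt, by simp, ?_⟩
    have h1 : ContDiffOn ℝ ∞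
        (fun z => (fderiv ℝ f z).comp (ContinuousLinearMap.inr ℝ ℝ H)) W :=
      (hf.fderiv_of_isOpen hW (by simp)).clm_comp contDiffOn_const
    exact (ih h1).congr fun x hx => (hd hf x hx).fderiv

end ParametricIntegral

/-! ### Differentiating path integrals of leafwise closed forms. -/

section LeafwisePotential

variable {n N : ℕ}

/-- The 1-form `η`, as a map into the dual space. -/
def OneForm.toDual (η : OneForm n) (y : Fin n → ℝ) : (Fin n → ℝ) →L[ℝ] ℝ :=
  ∑ k, η y k • ContinuousLinearMap.proj k

theorem OneForm.toDual_apply (η : OneForm n) (y v : Fin n → ℝ) :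
    η.toDual y v = ∑ k, η y k * v k := by
  simp [OneForm.toDual]

theorem OneForm.contDiffOn_toDual {η : OneForm n} {U : Set (Fin n → ℝ)}
    (hη : ∀ k, ContDiffOn ℝ ∞ (fun y => η y k) U) : ContDiffOn ℝ ∞ η.toDual U := by
  unfold OneForm.toDual
  exact ContDiffOn.sum fun k _ => (hη k).smul contDiffOn_const

theorem OneForm.fderiv_toDual_apply {η : OneForm n} {y : Fin n → ℝ}
    (hη : ∀ k, DifferentiableAt ℝ (fun y => η y k) y) (u v : Fin n → ℝ) :
    fderiv ℝ η.toDual y u v = ∑ k, fderiv ℝ (fun y => η y k) y u * v k := by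
  have h : HasFDerivAt η.toDual (∑ k, (fderiv ℝ (fun y => η y k) y).smulRight
      (ContinuousLinearMap.proj k : (Fin n → ℝ) →L[ℝ] ℝ)) y := by
    unfold OneForm.toDual
    exact HasFDerivAt.fun_sum fun k _ => (hη k).hasFDerivAt.smul_const
      (ContinuousLinearMap.proj k : (Fin n → ℝ) →L[ℝ] ℝ)
  rw [h.fderiv]
  simp

/-- The derivative, along the leaves, of the integral of a leafwise closed 1-form along a smooth
family of paths in the leaves. -/
theorem fderiv_integral_leafwise_closed {Q : Fin N → (Fin n → ℝ) → ℝ} {U U' : Set (Fin n → ℝ)}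
    (hU : IsOpen U) (hU' : IsOpen U') (hsub : U' ⊆ U)
    (hQ : ∀ l, ContDiffOn ℝ ∞ (Q l) U) {η : OneForm n}
    (hη : ∀ k, ContDiffOn ℝ ∞ (fun y => η y k) U) (hclosed : IsLeafwiseClosedOn Q U η)
    {g : ℝ × (Fin n → ℝ) → Fin n → ℝ} {W : Set (ℝ × (Fin n → ℝ))} (hW : IsOpen W)
    (hWU : ∀ x ∈ U', ∀ s ∈ Icc (0 : ℝ) 1, (s, x) ∈ W) (hg : ContDiffOn ℝ ∞ g W)
    (hgU : MapsTo g W U) (hleaf : ∀ x ∈ U', ∀ s ∈ Icc (0 : ℝ) 1, ∀ l, Q l (g (s, x)) = Q l x)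
    {x : Fin n → ℝ} (hx : x ∈ U') {v : Fin n → ℝ} (hv : ∀ l, fderiv ℝ (Q l) x v = 0) :
    fderiv ℝ (fun x => ∫ s in (0 : ℝ)..1, η.toDual (g (s, x)) (fderiv ℝ g (s, x) (1, 0))) x v =
      η.toDual (g (1, x)) (fderiv ℝ g (1, x) (0, v)) -
      η.toDual (g (0, x)) (fderiv ℝ g (0, x) (0, v)) := by
  have hηd := OneForm.contDiffOn_toDual hη
  have hg' : ContDiffOn ℝ ∞ (fderiv ℝ g) W := hg.fderiv_of_isOpen hW (by simp)
  have hηg : ContDiffOn ℝ ∞ (fun z => η.toDual (g z)) W := hηd.comp hg hgU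
  have hsm : ∀ w, ContDiffOn ℝ ∞ (fun z => η.toDual (g z) (fderiv ℝ g z w)) W := fun w =>
    hηg.clm_apply (hg'.clm_apply contDiffOn_const)
  have hd : ∀ z ∈ W, ∀ w : ℝ × (Fin n → ℝ), HasFDerivAt (fun z => η.toDual (g z) (fderiv ℝ g z w))
      ((η.toDual (g z)).comp ((fderiv ℝ (fderiv ℝ g) z).flip w) +
        ((fderiv ℝ η.toDual (g z)).comp (fderiv ℝ g z)).flip (fderiv ℝ g z w)) z := by
    intro z hz w
    have h1 : HasFDerivAt g (fderiv ℝ g z) z :=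
      ((hg.contDiffAt (hW.mem_nhds hz)).differentiableAt (by simp)).hasFDerivAt
    have h2 : HasFDerivAt (fderiv ℝ g) (fderiv ℝ (fderiv ℝ g) z) z :=
      ((hg'.contDiffAt (hW.mem_nhds hz)).differentiableAt (by simp)).hasFDerivAt
    have h3 : HasFDerivAt η.toDual (fderiv ℝ η.toDual (g z)) (g z) :=
      ((hηd.contDiffAt (hU.mem_nhds (hgU hz))).differentiableAt (by simp)).hasFDerivAt
    have h4 : HasFDerivAt (fun z => fderiv ℝ g z w) ((fderiv ℝ (fderiv ℝ g) z).flip w) z := by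
      refine (h2.clm_apply (hasFDerivAt_const w z)).congr_fderiv ?_
      rw [ContinuousLinearMap.comp_zero, zero_add]
    exact (h3.comp z h1).clm_apply h4
  have hQd : ∀ l, ∀ y ∈ U, HasFDerivAt (Q l) (fderiv ℝ (Q l) y) y := fun l y hy =>
    (((hQ l).contDiffAt (hU.mem_nhds hy)).differentiableAt (by simp)).hasFDerivAt
  have hgd : ∀ z ∈ W, HasFDerivAt g (fderiv ℝ g z) z := fun z hz =>
    ((hg.contDiffAt (hW.mem_nhds hz)).differentiableAt (by simp)).hasFDerivAt
  have hslice : ∀ s : ℝ, HasDerivAt (fun s : ℝ => (s, x)) (1, 0) s := fun s =>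
    (hasDerivAt_id s).prodMk (hasDerivAt_const s x)
  -- Differentiating `Q l (g (s, x)) = Q l x` in the direction `v`, and then in `s`, shows that both
  -- partial derivatives of `g` are tangent to the leaf, where closedness applies.
  have htan0 : ∀ s ∈ Icc (0 : ℝ) 1, ∀ l, fderiv ℝ (Q l) (g (s, x)) (fderiv ℝ g (s, x) (0, v)) = 0 := by
    intro s hs l
    have h1 := ((hQd l _ (hgU (hWU x hx s hs))).comp x
      ((hgd _ (hWU x hx s hs)).comp x (hasFDerivAt_prodMk_right s x)))
    have h2 : HasFDerivAt (Q l ∘ g ∘ fun e => (s, e)) (fderiv ℝ (Q l) x) x := by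
      refine (hQd l x (hsub hx)).congr_of_eventuallyEq ?_
      filter_upwards [hU'.mem_nhds hx] with y hy using hleaf y hy s hs l
    have h3 := congrArg (fun T => T v) (h1.unique h2)
    simpa [hv l] using h3
  have htan1 : ∀ s ∈ Icc (0 : ℝ) 1, ∀ l, fderiv ℝ (Q l) (g (s, x)) (fderiv ℝ g (s, x) (1, 0)) = 0 := by
    intro s hs l
    have h1 := (hQd l _ (hgU (hWU x hx s hs))).comp_hasDerivAt s
      ((hgd _ (hWU x hx s hs)).comp_hasDerivAt s (hslice s))
    -- The path is only known to stay in the leaf for `s ∈ [0, 1]`, so one-sided derivatives are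
    -- needed at the endpoints.
    have h2 : HasDerivWithinAt (Q l ∘ g ∘ fun s => (s, x)) 0 (Icc 0 1) s :=
      (hasDerivWithinAt_const s _ (Q l x)).congr (fun t ht => hleaf x hx t ht l)
        (hleaf x hx s hs l)
    exact (uniqueDiffOn_Icc zero_lt_one s hs).eq_deriv _ h1.hasDerivWithinAt h2
  have hF : ∀ s ∈ uIcc (0 : ℝ) 1, HasDerivAt
      (fun s => η.toDual (g (s, x)) (fderiv ℝ g (s, x) (0, v)))
      (fderiv ℝ (fun z => η.toDual (g z) (fderiv ℝ g z (0, v))) (s, x) (1, 0)) s := by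
    intro s hs
    rw [uIcc_of_le zero_le_one] at hs
    have := (hd _ (hWU x hx s hs) (0, v)).comp_hasDerivAt s (hslice s)
    rw [(hd _ (hWU x hx s hs) (0, v)).fderiv]
    exact this
  have hcd : ∀ w w', ContinuousOn
      (fun s => fderiv ℝ (fun z => η.toDual (g z) (fderiv ℝ g z w)) (s, x) w') (Icc (0 : ℝ) 1) := by
    intro w w'
    exact continuousOn_slice (f := fun z => fderiv ℝ
      (fun z => η.toDual (g z) (fderiv ℝ g z w)) z w')
      (((hsm w).continuousOn_fderiv_of_isOpen hW (by simp)).clm_apply continuousOn_const)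
      (hWU x hx)
  rw [← intervalIntegral.integral_eq_sub_of_hasDerivAt hF (ContinuousOn.intervalIntegrable (by
      rw [uIcc_of_le zero_le_one]; exact hcd _ _)),
    (hasFDerivAt_integral_zero_one hW ((hsm (1, 0)).of_le (by simp)) (hWU x hx)).fderiv,
    ContinuousLinearMap.intervalIntegral_apply]
  -- The `v`-derivative of `η(∂ₛg)` and the `s`-derivative of `η(∂ᵥg)` differ by `dη(∂ᵥg, ∂ₛg)` and
  -- by the commutator of second derivatives of `g`; both vanish.
  · refine intervalIntegral.integral_congr fun s hs => ?_
    rw [uIcc_of_le zero_le_one] at hs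
    have hz := hWU x hx s hs
    have hsymm : IsSymmSndFDerivAt ℝ g (s, x) :=
      (hg.contDiffAt (hW.mem_nhds hz)).isSymmSndFDerivAt (by
        rw [minSmoothness_of_isRCLikeNormedField]
        exact WithTop.coe_le_coe.2 (le_top : (2 : ℕ∞) ≤ ⊤))
    have hcl := hclosed (g (s, x)) (hgU hz) _ _ (htan0 s hs) (htan1 s hs)
    have hηk : ∀ k, DifferentiableAt ℝ (fun y => η y k) (g (s, x)) := fun k =>
      ((hη k).contDiffAt (hU.mem_nhds (hgU hz))).differentiableAt (by simp)
    rw [Finset.sum_sub_distrib, ← OneForm.fderiv_toDual_apply hηk,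
      ← OneForm.fderiv_toDual_apply hηk, sub_eq_zero] at hcl
    simp only [(hd _ hz _).fderiv, ContinuousLinearMap.comp_apply, ContinuousLinearMap.inr_apply,
      add_apply, ContinuousLinearMap.flip_apply]
    rw [hcl, hsymm.eq (0, v) (1, 0)]
  · refine ContinuousOn.intervalIntegrable ?_
    rw [uIcc_of_le zero_le_one]
    exact continuousOn_slice (((hsm _).continuousOn_fderiv_of_isOpen hW (by simp)).clm_comp
      continuousOn_const) (hWU x hx)

end LeafwisePotential

/-! ### Calculus of known smooth functions. -/

section KnownFunctions

theorem Known.mono {G G' : FunClass} (hG : ∀ m U f, G m U f → Known G' m U f) {m : ℕ}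
    {U : Set (Fin m → ℝ)} {f : (Fin m → ℝ) → ℝ} (hf : Known G m U f) : Known G' m U f := by
  induction hf with
  | gen h => exact hG _ _ _ h
  | const hU c => exact .const hU c
  | coord hU i => exact .coord hU i
  | restrict _ hU' hsub heq ih => exact .restrict ih hU' hsub heq
  | add _ _ ihf ihg => exact .add ihf ihg
  | mul _ _ ihf ihg => exact .mul ihf ihg
  | inv _ hne ih => exact .inv ih hne
  | comp hU _ _ hmaps ihf ihg => exact .comp hU ihf ihg hmaps
  | partialDeriv _ i ih => exact .partialDeriv ih i
  | elim _ hU hg hmem hzero hdet j ih => exact .elim ih hU hg hmem hzero hdet j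

/-- A function which is known on the open set `U` and smooth there. -/
structure KnownSmooth (G : FunClass) {m : ℕ} (U : Set (Fin m → ℝ)) (f : (Fin m → ℝ) → ℝ) :
    Prop where
  known : Known G m U f
  contDiffOn : ContDiffOn ℝ ∞ f U

namespace KnownSmooth

variable {G : FunClass} {m k : ℕ} {U U' : Set (Fin m → ℝ)} {f g : (Fin m → ℝ) → ℝ}

theorem mono_class {G' : FunClass} (hG : ∀ m U f, G m U f → Known G' m U f)
    (hf : KnownSmooth G U f) : KnownSmooth G' U f :=
  ⟨hf.known.mono hG, hf.contDiffOn⟩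

theorem const (hU : IsOpen U) (c : ℝ) : KnownSmooth G U (fun _ => c) :=
  ⟨.const hU c, contDiffOn_const⟩

theorem coord (hU : IsOpen U) (i : Fin m) : KnownSmooth G U (fun x => x i) :=
  ⟨.coord hU i, (contDiff_apply ℝ ℝ i).contDiffOn⟩

theorem mono (hf : KnownSmooth G U f) (hU' : IsOpen U') (hsub : U' ⊆ U) : KnownSmooth G U' f :=
  ⟨.restrict hf.known hU' hsub fun _ _ => rfl, hf.contDiffOn.mono hsub⟩

theorem congr (hf : KnownSmooth G U f) (hU : IsOpen U) (h : EqOn g f U) : KnownSmooth G U g :=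
  ⟨.restrict hf.known hU Subset.rfl h, hf.contDiffOn.congr h⟩

theorem add (hf : KnownSmooth G U f) (hg : KnownSmooth G U g) :
    KnownSmooth G U (fun x => f x + g x) :=
  ⟨.add hf.known hg.known, hf.contDiffOn.add hg.contDiffOn⟩

theorem mul (hf : KnownSmooth G U f) (hg : KnownSmooth G U g) :
    KnownSmooth G U (fun x => f x * g x) :=
  ⟨.mul hf.known hg.known, hf.contDiffOn.mul hg.contDiffOn⟩

theorem inv (hf : KnownSmooth G U f) (hne : ∀ x ∈ U, f x ≠ 0) :
    KnownSmooth G U (fun x => (f x)⁻¹) :=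
  ⟨.inv hf.known hne, hf.contDiffOn.inv hne⟩

theorem const_mul (hU : IsOpen U) (c : ℝ) (hf : KnownSmooth G U f) :
    KnownSmooth G U (fun x => c * f x) :=
  (const hU c).mul hf

theorem sub (hU : IsOpen U) (hf : KnownSmooth G U f) (hg : KnownSmooth G U g) :
    KnownSmooth G U (fun x => f x - g x) :=
  (hf.add (hg.const_mul hU (-1))).congr hU fun x _ => by ring

theorem comp {W : Set (Fin k → ℝ)} {f : (Fin k → ℝ) → ℝ} {g : (Fin m → ℝ) → Fin k → ℝ}
    (hf : KnownSmooth G W f) (hU : IsOpen U) (hg : ∀ i, KnownSmooth G U (fun x => g x i))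
    (hmaps : MapsTo g U W) : KnownSmooth G U (fun x => f (g x)) :=
  ⟨.comp hU hf.known (fun i => (hg i).known) hmaps,
    hf.contDiffOn.comp (contDiffOn_pi.2 fun i => (hg i).contDiffOn) hmaps⟩

theorem sum {ι : Type*} (hU : IsOpen U) (s : Finset ι) {f : ι → (Fin m → ℝ) → ℝ}
    (hf : ∀ i ∈ s, KnownSmooth G U (f i)) : KnownSmooth G U (fun x => ∑ i ∈ s, f i x) := by
  classical
  induction s using Finset.induction_on with
  | empty => simpa using const hU 0
  | insert a s ha ih =>
    simp only [Finset.sum_insert ha]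
    exact (hf a (Finset.mem_insert_self a s)).add
      (ih fun i hi => hf i (Finset.mem_insert_of_mem hi))

theorem prod {ι : Type*} (hU : IsOpen U) (s : Finset ι) {f : ι → (Fin m → ℝ) → ℝ}
    (hf : ∀ i ∈ s, KnownSmooth G U (f i)) : KnownSmooth G U (fun x => ∏ i ∈ s, f i x) := by
  classical
  induction s using Finset.induction_on with
  | empty => simpa using const hU 1
  | insert a s ha ih =>
    simp only [Finset.prod_insert ha]
    exact (hf a (Finset.mem_insert_self a s)).mul
      (ih fun i hi => hf i (Finset.mem_insert_of_mem hi))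

theorem linearMap_apply (hU : IsOpen U) {f : (Fin m → ℝ) → Fin k → ℝ}
    (hf : ∀ i, KnownSmooth G U (fun x => f x i)) (T : (Fin k → ℝ) →ₗ[ℝ] ℝ) :
    KnownSmooth G U (fun x => T (f x)) := by
  refine (sum hU Finset.univ fun i _ => (hf i).const_mul hU (T (Pi.single i 1))).congr hU
    fun x _ => ?_
  conv_lhs => rw [pi_eq_sum_univ' (f x)]
  simp [mul_comm]

theorem det (hU : IsOpen U) {A : (Fin m → ℝ) → Matrix (Fin k) (Fin k) ℝ}
    (hA : ∀ i j, KnownSmooth G U (fun x => A x i j)) : KnownSmooth G U (fun x => (A x).det) := by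
  simp only [Matrix.det_apply']
  exact sum hU _ fun σ _ => (prod hU _ fun i _ => hA _ _).const_mul hU _

/-- Cramer's rule: each entry is a determinant of known entries, one row being replaced by a unit
vector, divided by `det A`. -/
theorem matrix_inv (hU : IsOpen U) {A : (Fin m → ℝ) → Matrix (Fin k) (Fin k) ℝ}
    (hA : ∀ i j, KnownSmooth G U (fun x => A x i j)) (hdet : ∀ x ∈ U, (A x).det ≠ 0)
    (i j : Fin k) : KnownSmooth G U (fun x => (A x)⁻¹ i j) := by
  simp only [Matrix.inv_def, Ring.inverse_eq_inv', Matrix.smul_apply, smul_eq_mul,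
    Matrix.adjugate_apply]
  refine ((det hU hA).inv hdet).mul (det hU fun a b => ?_)
  by_cases h : a = j
  · subst h
    simpa using const hU _
  · simpa [Matrix.updateRow_ne h] using hA a b

/-- A known smooth map with invertible derivative at `p` has a known smooth local inverse. -/
theorem exists_local_inverse (hU : IsOpen U) {Ψ : (Fin m → ℝ) → Fin m → ℝ}
    (hΨ : ∀ i, KnownSmooth G U (fun y => Ψ y i)) {p : Fin m → ℝ} (hp : p ∈ U)
    {D : (Fin m → ℝ) ≃L[ℝ] (Fin m → ℝ)} (hD : HasFDerivAt Ψ (D : (Fin m → ℝ) →L[ℝ] Fin m → ℝ) p) :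
    ∃ e : OpenPartialHomeomorph (Fin m → ℝ) (Fin m → ℝ), ⇑e = Ψ ∧ p ∈ e.source ∧ e.source ⊆ U ∧
      ∀ i, KnownSmooth G e.target (fun c => e.symm c i) := by
  have hsm : ContDiffOn ℝ ∞ Ψ U := contDiffOn_pi.2 fun i => (hΨ i).contDiffOn
  have hpa : ContDiffAt ℝ ∞ Ψ p := hsm.contDiffAt (hU.mem_nhds hp)
  -- Both elimination and smoothness of the inverse need an invertible derivative at every point of
  -- the source, not only at `p`.
  set S : Set (Fin m → ℝ) := U ∩ fderiv ℝ Ψ ⁻¹'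
    range ((↑) : ((Fin m → ℝ) ≃L[ℝ] (Fin m → ℝ)) → (Fin m → ℝ) →L[ℝ] (Fin m → ℝ)) with hS
  have hSo : IsOpen S := (hsm.continuousOn_fderiv_of_isOpen hU (by simp)).isOpen_inter_preimage hU
    ContinuousLinearEquiv.isOpen
  set e := (hpa.toOpenPartialHomeomorph Ψ hD (by simp)).restrOpen S hSo with he
  have hcoe : ⇑e = Ψ := rfl
  have heS : e.source ⊆ S := inter_subset_right
  have hmem : ∀ c ∈ e.target, e.symm c ∈ S := fun c hc => heS (e.map_target hc)
  have hder : ∀ c ∈ e.target, ∃ D' : (Fin m → ℝ) ≃L[ℝ] (Fin m → ℝ),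
      HasFDerivAt Ψ (D' : (Fin m → ℝ) →L[ℝ] (Fin m → ℝ)) (e.symm c) := by
    intro c hc
    obtain ⟨hcU, D', hD'⟩ := hmem c hc
    refine ⟨D', hD' ▸ ?_⟩
    exact ((hsm.contDiffAt (hU.mem_nhds hcU)).differentiableAt (by simp)).hasFDerivAt
  have hesm : ContDiffOn ℝ ∞ e.symm e.target := fun c hc => by
    obtain ⟨D', hD'⟩ := hder c hc
    exact (e.contDiffAt_symm hc hD'
      (hsm.contDiffAt (hU.mem_nhds (hmem c hc).1))).contDiffWithinAt
  refine ⟨e, hcoe, ⟨hpa.mem_toOpenPartialHomeomorph_source hD (by simp), hp, D, hD.fderiv.symm⟩,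
    heS.trans inter_subset_left, fun i => ⟨?_, contDiffOn_pi.1 hesm i⟩⟩
  set W : Set (Fin (m + m) → ℝ) := (fun z k => z (Fin.natAdd m k)) ⁻¹' U with hW
  have hWo : IsOpen W := hU.preimage (by fun_prop)
  have happ : ∀ x y : Fin m → ℝ, (fun k => Fin.append x y (Fin.natAdd m k)) = y := fun x y => by
    ext k; exact Fin.append_right x y k
  -- The inverse solves the system `Ψ(y) - c = 0` for `y`; its Jacobian with respect to `y` is that
  -- of `Ψ`.
  refine Known.elim (W := W)
    (F := fun i z => Ψ (fun k => z (Fin.natAdd m k)) i - z (Fin.castAdd m i)) (fun i => ?_)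
    e.open_target hesm.continuousOn (fun c hc => ?_) (fun c hc i => ?_) (fun c hc => ?_) i
  · exact (((hΨ i).comp hWo (fun k => coord hWo _) fun z hz => hz).sub hWo (coord hWo _)).known
  · rw [hW, mem_preimage, happ]
    exact (hmem c hc).1
  · have := e.right_inv hc
    rw [hcoe] at this
    simp only [happ, this, Fin.append_left, sub_self]
  · obtain ⟨D', hD'⟩ := hder c hc
    have hF : ∀ i j, fderiv ℝ
        (fun z : Fin (m + m) → ℝ => Ψ (fun k => z (Fin.natAdd m k)) i - z (Fin.castAdd m i))
        (Fin.append c (e.symm c)) (Pi.single (Fin.natAdd m j) 1) = D' (Pi.single j 1) i := by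
      intro i j
      let P : (Fin (m + m) → ℝ) →L[ℝ] Fin m → ℝ :=
        ContinuousLinearMap.pi fun k => ContinuousLinearMap.proj (Fin.natAdd m k)
      have hP : P (Fin.append c (e.symm c)) = e.symm c := happ _ _
      have h1 : HasFDerivAt (fun z => Ψ (P z)) ((D' : (Fin m → ℝ) →L[ℝ] Fin m → ℝ).comp P)
          (Fin.append c (e.symm c)) :=
        HasFDerivAt.comp (g := Ψ) _ (by rw [hP]; exact hD') P.hasFDerivAt
      have h2 := (hasFDerivAt_pi'.1 h1 i).sub
        (hasFDerivAt_apply (𝕜 := ℝ) (Fin.castAdd m i) (Fin.append c (e.symm c)))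
      have h3 : P (Pi.single (Fin.natAdd m j) 1) = Pi.single j 1 := by
        ext k
        simp [P, Pi.single_apply, Fin.ext_iff]
      have h4 : (Pi.single (Fin.natAdd m j) 1 : Fin (m + m) → ℝ) (Fin.castAdd m i) = 0 := by
        rw [Pi.single_eq_of_ne]
        simp [Fin.ext_iff]; omega
      refine (congrArg (fun T => T (Pi.single (Fin.natAdd m j) 1)) h2.fderiv).trans ?_
      simp only [sub_apply, ContinuousLinearMap.comp_apply, h3, ContinuousLinearMap.proj_apply, h4, sub_zero]
      rfl
    have hM : (Matrix.of fun i j => fderiv ℝ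
        (fun z : Fin (m + m) → ℝ => Ψ (fun k => z (Fin.natAdd m k)) i - z (Fin.castAdd m i))
        (Fin.append c (e.symm c)) (Pi.single (Fin.natAdd m j) 1)) =
        LinearMap.toMatrix' (D'.toLinearEquiv : (Fin m → ℝ) →ₗ[ℝ] Fin m → ℝ) := by
      ext i j
      simp only [Matrix.of_apply, hF, LinearMap.toMatrix'_apply]
      rfl
    rw [hM, LinearMap.det_toMatrix']
    exact (LinearEquiv.isUnit_det' D'.toLinearEquiv).ne_zero

end KnownSmooth

end KnownFunctions

/-! ### Linearizing coordinates and paths in the leaves. -/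

section Splitting

variable {n N : ℕ} {G : FunClass} {Q : Fin N → (Fin n → ℝ) → ℝ} {U : Set (Fin n → ℝ)}
  {p : Fin n → ℝ}

/-- A nonzero functional vanishing on a proper range would be a linear relation among the `f l`. -/
theorem surjective_pi_of_linearIndependent {f : Fin N → (Fin n → ℝ) →L[ℝ] ℝ}
    (hf : LinearIndependent ℝ f) :
    Function.Surjective (ContinuousLinearMap.pi f : (Fin n → ℝ) →L[ℝ] Fin N → ℝ) := by
  by_contra hs
  have hlt : LinearMap.range (ContinuousLinearMap.pi f).toLinearMap < ⊤ :=
    lt_top_iff_ne_top.2 fun h => hs (LinearMap.range_eq_top.1 h)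
  obtain ⟨φ, hφ, hle⟩ := Submodule.exists_le_ker_of_lt_top _ hlt
  refine hφ (LinearMap.pi_ext' fun l => LinearMap.ext_ring ?_)
  have hsum : ∑ l, φ (Pi.single l 1) • f l = 0 := by
    ext v
    have h1 : φ (fun l => f l v) = 0 := hle ⟨v, rfl⟩
    rw [pi_eq_sum_univ' (fun l => f l v)] at h1
    simpa [mul_comm] using h1
  simpa using Fintype.linearIndependent_iff.1 hf _ hsum l

/-- Near a point at which the known functions `Q_l` are independent there is a known local
diffeomorphism of `ℝⁿ` which makes them linear. -/
theorem exists_linearizing (hU : IsOpen U) (hp : p ∈ U) (hQ : ∀ l, KnownSmooth G U (Q l))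
    (hind : LinearIndependent ℝ fun l => fderiv ℝ (Q l) p) :
    ∃ (L : (Fin n → ℝ) →L[ℝ] Fin N → ℝ) (R : (Fin N → ℝ) →L[ℝ] Fin n → ℝ)
      (e : OpenPartialHomeomorph (Fin n → ℝ) (Fin n → ℝ)),
      (∀ c, L (R c) = c) ∧ (∀ v l, L v l = fderiv ℝ (Q l) p v) ∧ p ∈ e.source ∧ e.source ⊆ U ∧
      (∀ y ∈ e.source, L (e y) = fun l => Q l y) ∧
      (∀ y, e y = y + R ((fun l => Q l y) - L y)) ∧
      (∀ k, KnownSmooth G e.source (fun y => e y k)) ∧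
      ∀ k, KnownSmooth G e.target (fun y => e.symm y k) := by
  set L : (Fin n → ℝ) →L[ℝ] Fin N → ℝ := ContinuousLinearMap.pi fun l => fderiv ℝ (Q l) p with hL
  obtain ⟨R, hR⟩ := L.toLinearMap.exists_rightInverse_of_surjective
    (LinearMap.range_eq_top.2 (surjective_pi_of_linearIndependent hind))
  have hLR : ∀ c, L (R c) = c := fun c => congrArg (fun T => T c) hR
  have hQ' : HasFDerivAt (fun y l => Q l y) L p := hasFDerivAt_pi.2 fun l =>
    (((hQ l).contDiffOn.contDiffAt (hU.mem_nhds hp)).differentiableAt (by simp)).hasFDerivAt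
  -- The correction term has derivative zero at `p`, so `dΨ(p) = id`; and `L R = id` gives `L ∘ Ψ =
  -- Q`.
  set Ψ : (Fin n → ℝ) → Fin n → ℝ := fun y => y + R ((fun l => Q l y) - L y) with hΨ
  have hΨk : ∀ k, KnownSmooth G U (fun y => Ψ y k) := fun k => by
    refine (KnownSmooth.coord hU k).add (KnownSmooth.linearMap_apply hU
      (f := fun y => (fun l => Q l y) - L y) (fun l => (hQ l).sub hU ?_) (LinearMap.proj k ∘ₗ R))
    exact KnownSmooth.linearMap_apply hU (f := fun y => y) (fun i => .coord hU i)
      (LinearMap.proj l ∘ₗ L.toLinearMap)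
  have hD : HasFDerivAt Ψ
      (ContinuousLinearEquiv.refl ℝ (Fin n → ℝ) : (Fin n → ℝ) →L[ℝ] Fin n → ℝ) p := by
    refine ((hasFDerivAt_id p).add ((LinearMap.toContinuousLinearMap R).hasFDerivAt.comp p
      (hQ'.sub L.hasFDerivAt))).congr_fderiv ?_
    ext v k
    simp
  obtain ⟨e, he, hpe, heU, hsymm⟩ := KnownSmooth.exists_local_inverse hU hΨk hp hD
  refine ⟨L, LinearMap.toContinuousLinearMap R, e, hLR, fun v l => rfl, hpe, heU, fun y _ => ?_,
    fun y => by rw [he]; rfl, fun k => by rw [he]; exact (hΨk k).mono e.open_source heU, hsymm⟩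
  rw [he, hΨ]
  simp only [map_add, hLR]
  abel

theorem contDiff_cons {n : ℕ} :
    ContDiff ℝ ∞ (fun z : ℝ × (Fin n → ℝ) => (Fin.cons z.1 z.2 : Fin (n + 1) → ℝ)) := by
  refine contDiff_pi.2 (Fin.cases ?_ fun i => ?_)
  · simpa using contDiff_fst
  · simp only [Fin.cons_succ]
    exact (contDiff_apply ℝ ℝ i).comp contDiff_snd

theorem continuous_tail {n : ℕ} : Continuous (fun z : Fin (n + 1) → ℝ => Fin.tail z) :=
  continuous_pi fun i => continuous_apply (Fin.succ i)

/-- The tube lemma in `Fin.cons` coordinates. It is used with `s = [0, 1]` for paths and `s = {0}`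
for the flow. -/
theorem exists_box_subset {n : ℕ} {s : Set ℝ} (hs : IsCompact s) {W : Set (Fin (n + 1) → ℝ)}
    (hW : IsOpen W) {p : Fin n → ℝ} (hp : ∀ t ∈ s, (Fin.cons t p : Fin (n + 1) → ℝ) ∈ W) :
    ∃ (u : Set ℝ) (v : Set (Fin n → ℝ)), IsOpen u ∧ IsOpen v ∧ s ⊆ u ∧ p ∈ v ∧
      ∀ t ∈ u, ∀ x ∈ v, (Fin.cons t x : Fin (n + 1) → ℝ) ∈ W := by
  obtain ⟨u, v, hu, hv, hsu, hpv, huv⟩ := generalized_tube_lemma hs (isCompact_singleton (x := p))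
    (hW.preimage contDiff_cons.continuous)
    (fun z hz => by obtain ⟨hz1, hz2⟩ := hz; rw [mem_singleton_iff] at hz2
                    rw [mem_preimage, hz2]; exact hp _ hz1)
  exact ⟨u, v, hu, hv, hsu, hpv rfl, fun t ht x hx => huv (mk_mem_prod ht hx)⟩

/-- Near a point at which the known functions `Q_l` are independent there is a known family of
paths in their leaves. -/
theorem exists_isLeafwisePathFamily (hU : IsOpen U) (hp : p ∈ U) (hQ : ∀ l, KnownSmooth G U (Q l))
    (hind : LinearIndependent ℝ fun l => fderiv ℝ (Q l) p) :
    ∃ (U' : Set (Fin n → ℝ)) (W : Set (Fin (n + 1) → ℝ)) (γ : (Fin (n + 1) → ℝ) → Fin n → ℝ),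
      IsOpen U' ∧ p ∈ U' ∧ U' ⊆ U ∧ IsLeafwisePathFamily G Q U U' γ ∧ IsOpen W ∧
      (∀ x ∈ U', ∀ s ∈ Icc (0 : ℝ) 1, (Fin.cons s x : Fin (n + 1) → ℝ) ∈ W) ∧
      ContDiffOn ℝ ∞ γ W ∧ MapsTo γ W U ∧
      ∀ x ∈ U', ∀ v, (∀ l, fderiv ℝ (Q l) x v = 0) →
        fderiv ℝ (fun x => γ (Fin.cons 0 x)) x v = 0 := by
  obtain ⟨L, R, e, hLR, -, hpe, heU, hLe, -, hek, hsymm⟩ := exists_linearizing hU hp hQ hind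
  set π : (Fin n → ℝ) →L[ℝ] Fin n → ℝ := ContinuousLinearMap.id ℝ _ - R.comp L with hπ
  have hπa : ∀ c, π c = c - R (L c) := fun c => rfl
  have hLπ : ∀ c, L (π c) = 0 := fun c => by rw [hπa, map_sub, hLR, sub_self]
  -- In the linearizing coordinates the path is a segment. As `π` projects onto `ker L`, the value
  -- of `L`, hence the leaf, is constant along it. It ends at `e x` and starts at `R (Q x) + π (e
  -- p)`, which depends on `x` only through `Q x`.
  set h : (Fin (n + 1) → ℝ) → Fin n → ℝ :=
    fun z => e (Fin.tail z) - (1 - z 0) • π (e (Fin.tail z) - e p) with hh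
  set W₀ : Set (Fin (n + 1) → ℝ) := Fin.tail ⁻¹' e.source with hW₀
  have hW₀o : IsOpen W₀ := e.open_source.preimage continuous_tail
  have htail : ∀ k, KnownSmooth G W₀ (fun z => e (Fin.tail z) k) := fun k =>
    (hek k).comp hW₀o (fun i => .coord hW₀o _) fun z hz => hz
  have hhk : ∀ k, KnownSmooth G W₀ (fun z => h z k) := fun k => by
    refine (htail k).sub hW₀o (((KnownSmooth.const hW₀o 1).sub hW₀o (.coord hW₀o 0)).mul
      (KnownSmooth.linearMap_apply hW₀o (f := fun z => e (Fin.tail z) - e p)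
        (fun i => (htail i).sub hW₀o (.const hW₀o _)) (LinearMap.proj k ∘ₗ π.toLinearMap)))
  have hhs : ContDiffOn ℝ ∞ h W₀ := contDiffOn_pi.2 fun k => (hhk k).contDiffOn
  have hWo : IsOpen (W₀ ∩ h ⁻¹' e.target) := hhs.continuousOn.isOpen_inter_preimage hW₀o e.open_target
  have hgk : ∀ k, KnownSmooth G (W₀ ∩ h ⁻¹' e.target) (fun z => e.symm (h z) k) := fun k =>
    (hsymm k).comp hWo (fun i => (hhk i).mono hWo inter_subset_left) fun z hz => hz.2
  obtain ⟨u, v, -, hv, hu1, hpv, huv⟩ := exists_box_subset (isCompact_Icc (a := (0 : ℝ)) (b := 1))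
    hWo (p := p) (fun t _ => by
      refine ⟨hpe, ?_⟩
      simp only [hh, mem_preimage, Fin.tail_cons, sub_self, map_zero, smul_zero, sub_zero]
      exact e.map_source hpe)
  have hW : ∀ x ∈ v, ∀ s ∈ Icc (0 : ℝ) 1,
      (Fin.cons s x : Fin (n + 1) → ℝ) ∈ W₀ ∩ h ⁻¹' e.target := fun x hx s hs => huv s (hu1 hs) x hx
  have hmaps : MapsTo (fun z => e.symm (h z)) (W₀ ∩ h ⁻¹' e.target) U := fun z hz =>
    heU (e.map_target hz.2)
  have hve : v ⊆ e.source := fun x hx => (hW x hx 0 (by simp)).1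
  have hh0 : ∀ x ∈ v, h (Fin.cons 0 x) = R (fun l => Q l x) + π (e p) := fun x hx => by
    simp only [hh, Fin.tail_cons, Fin.cons_zero, sub_zero, one_smul, map_sub]
    rw [hπa (e x), hLe x (hve hx)]
    abel
  refine ⟨v, W₀ ∩ h ⁻¹' e.target, fun z => e.symm (h z), hv, hpv, hve.trans heU,
    ⟨⟨_, hWo, hW, fun k => (hgk k).known⟩, fun x hx s hs => hmaps (hW x hx s hs),
      fun x hx s hs l => ?_, fun x hx => ?_, fun x hx x' hx' hxx' => ?_⟩, hWo, hW,
    contDiffOn_pi.2 fun k => (hgk k).contDiffOn, hmaps, fun x hx w hw => ?_⟩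
  · have hz := (hW x hx s hs).2
    have h1 := hLe _ (e.map_target hz)
    have h2 : L (h (Fin.cons s x)) = fun l => Q l x := by
      simp only [hh, map_sub, map_smul, hLπ, Fin.tail_cons, hLe x (hve hx), sub_self, smul_zero,
        sub_zero]
    rw [e.right_inv hz, h2] at h1
    exact (congrFun h1 l).symm
  · simp only [hh, Fin.tail_cons, Fin.cons_zero, sub_self, zero_smul, sub_zero]
    exact e.left_inv (hve hx)
  · simp only [hh0 x hx, hh0 x' hx', hxx']
  · have hQ' : HasFDerivAt (fun y l => Q l y)
        (ContinuousLinearMap.pi fun l => fderiv ℝ (Q l) x) x := hasFDerivAt_pi.2 fun l =>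
      (((hQ l).contDiffOn.contDiffAt (hU.mem_nhds (heU (hve hx)))).differentiableAt
        (by simp)).hasFDerivAt
    have h1 : HasFDerivAt (fun y => R (fun l => Q l y) + π (e p)) _ x :=
      (R.hasFDerivAt.comp x hQ').add_const (π (e p))
    have ht : R (fun l => Q l x) + π (e p) ∈ e.target := hh0 x hx ▸ (hW x hx 0 (by simp)).2
    have h2 : HasFDerivAt e.symm (fderiv ℝ e.symm (R (fun l => Q l x) + π (e p)))
        (R (fun l => Q l x) + π (e p)) :=
      (((contDiffOn_pi.2 fun k => (hsymm k).contDiffOn).contDiffAt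
        (e.open_target.mem_nhds ht)).differentiableAt (by simp : (∞ : WithTop ℕ∞) ≠ 0)).hasFDerivAt
    have h3 := (h2.comp x h1).congr_of_eventuallyEq
      (f₁ := fun x => e.symm (h (Fin.cons 0 x))) (by
        filter_upwards [hv.mem_nhds hx] with y hy
        simp only [hh0 y hy, Function.comp_apply])
    rw [h3.fderiv]
    have h4 : (ContinuousLinearMap.pi fun l => fderiv ℝ (Q l) x) w = 0 := funext hw
    simp only [ContinuousLinearMap.comp_apply, h4, map_zero]

end Splitting

/-! ### Leafwise potentials given by line integrals. -/

section LineIntegral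

variable {n N : ℕ}

/-- The integral of a smooth leafwise closed 1-form along a smooth family of paths in the leaves
is a smooth function, and a potential on each leaf. -/
theorem lineIntegral_leafwise {G : FunClass} {Q : Fin N → (Fin n → ℝ) → ℝ} {U U' : Set (Fin n → ℝ)}
    (hU : IsOpen U) (hU' : IsOpen U') (hsub : U' ⊆ U)
    (hQ : ∀ l, ContDiffOn ℝ ∞ (Q l) U) {η : OneForm n}
    (hη : ∀ k, ContDiffOn ℝ ∞ (fun y => η y k) U) (hclosed : IsLeafwiseClosedOn Q U η)
    {γ : (Fin (n + 1) → ℝ) → Fin n → ℝ} (hγ : IsLeafwisePathFamily G Q U U' γ)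
    {W : Set (Fin (n + 1) → ℝ)} (hW : IsOpen W)
    (hWU : ∀ x ∈ U', ∀ s ∈ Icc (0 : ℝ) 1, (Fin.cons s x : Fin (n + 1) → ℝ) ∈ W)
    (hγs : ContDiffOn ℝ ∞ γ W) (hγU : MapsTo γ W U)
    (hγ0 : ∀ x ∈ U', ∀ v, (∀ l, fderiv ℝ (Q l) x v = 0) →
        fderiv ℝ (fun x => γ (Fin.cons 0 x)) x v = 0) :
    ContDiffOn ℝ ∞ (lineIntegral γ η) U' ∧
      ∀ x ∈ U', ∀ v, (∀ l, fderiv ℝ (Q l) x v = 0) →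
        fderiv ℝ (lineIntegral γ η) x v = η.toDual x v := by
  set g : ℝ × (Fin n → ℝ) → Fin n → ℝ := fun z => γ (Fin.cons z.1 z.2) with hg
  set W' : Set (ℝ × (Fin n → ℝ)) :=
    (fun z => (Fin.cons z.1 z.2 : Fin (n + 1) → ℝ)) ⁻¹' W with hW'
  have hW'o : IsOpen W' := hW.preimage contDiff_cons.continuous
  have hgs : ContDiffOn ℝ ∞ g W' := hγs.comp contDiff_cons.contDiffOn fun z hz => hz
  have hgd : ∀ z ∈ W', HasFDerivAt g (fderiv ℝ g z) z := fun z hz =>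
    ((hgs.contDiffAt (hW'o.mem_nhds hz)).differentiableAt (by simp)).hasFDerivAt
  have heq : EqOn (lineIntegral γ η)
      (fun x => ∫ s in (0 : ℝ)..1, η.toDual (g (s, x)) (fderiv ℝ g (s, x) (1, 0))) U' := by
    intro x hx
    refine intervalIntegral.integral_congr fun s hs => ?_
    rw [uIcc_of_le zero_le_one] at hs
    simp only [OneForm.toDual_apply]
    refine Finset.sum_congr rfl fun k _ => ?_
    have h1 := (hgd _ (hWU x hx s hs)).comp_hasDerivAt s
      ((hasDerivAt_id s).prodMk (hasDerivAt_const s x))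
    exact congrArg (η (g (s, x)) k * ·) (hasDerivAt_pi.1 h1 k).deriv
  have hsm : ContDiffOn ℝ ∞ (fun z => η.toDual (g z) (fderiv ℝ g z (1, 0))) W' :=
    ((OneForm.contDiffOn_toDual hη).comp hgs fun z hz => hγU hz).clm_apply
      ((hgs.fderiv_of_isOpen hW'o (by simp)).clm_apply contDiffOn_const)
  refine ⟨(contDiffOn_integral_zero_one hW'o hU' hsm hWU).congr heq, fun x hx v hv => ?_⟩
  rw [(heq.eventuallyEq_of_mem (hU'.mem_nhds hx)).fderiv_eq,
    fderiv_integral_leafwise_closed hU hU' hsub hQ hη hclosed hW'o hWU hgs (fun z hz => hγU hz)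
      hγ.mem_leaf hx hv]
  have hs : ∀ s ∈ Icc (0 : ℝ) 1, HasFDerivAt (fun y => γ (Fin.cons s y))
      ((fderiv ℝ g (s, x)).comp (ContinuousLinearMap.inr ℝ ℝ _)) x := fun s hs =>
    (hgd (s, x) (hWU x hx s hs)).comp x (hasFDerivAt_prodMk_right s x)
  -- The starting point is constant along the leaf, and the endpoint is `x` itself, so only `η(v)`
  -- at `s = 1` survives.
  have h0 : fderiv ℝ g (0, x) (0, v) = 0 := by
    rw [← hγ0 x hx v hv, (hs 0 (by simp)).fderiv]
    rfl
  have h1 : fderiv ℝ g (1, x) (0, v) = v := by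
    have h2 : HasFDerivAt (fun y => γ (Fin.cons 1 y)) (ContinuousLinearMap.id ℝ _) x :=
      (hasFDerivAt_id x).congr_of_eventuallyEq (by
        filter_upwards [hU'.mem_nhds hx] with y hy using hγ.target y hy)
    exact congrArg (fun T => T v) ((hs 1 (by simp)).unique h2)
  rw [h0, h1, map_zero, sub_zero]
  exact congrArg (fun y => η.toDual y v) (hγ.target x hx)

end LineIntegral

/-! ### Constant-coefficient fields and forms in a frame. -/

section Frames

variable {n N : ℕ}

/-- The matrix whose columns are the vectors of the frame `E` at `y`. -/
def frameMatrix (E : Fin n → (Fin n → ℝ) → Fin n → ℝ) (y : Fin n → ℝ) :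
    Matrix (Fin n) (Fin n) ℝ :=
  Matrix.of fun k j => E j y k

/-- The vector field with constant coefficients `a` in the frame `E`. -/
def frameField (E : Fin n → (Fin n → ℝ) → Fin n → ℝ) (a y : Fin n → ℝ) : Fin n → ℝ :=
  Matrix.mulVec (frameMatrix E y) a

/-- The 1-form with constant coefficients `ℓ` in the coframe dual to `E`. -/
noncomputable def coframeForm (E : Fin n → (Fin n → ℝ) → Fin n → ℝ) (ℓ : (Fin n → ℝ) →ₗ[ℝ] ℝ) : OneForm n :=
  fun y k => ℓ fun j => (frameMatrix E y)⁻¹ j k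

/-- `E` is a frame on the open set `U` whose components are known and smooth. -/
structure IsKnownFrame (G : FunClass) (U : Set (Fin n → ℝ))
    (E : Fin n → (Fin n → ℝ) → Fin n → ℝ) : Prop where
  isOpen : IsOpen U
  known : ∀ j k, KnownSmooth G U (fun y => E j y k)
  det_ne_zero : ∀ y ∈ U, (frameMatrix E y).det ≠ 0

variable {G : FunClass} {U : Set (Fin n → ℝ)} {E : Fin n → (Fin n → ℝ) → Fin n → ℝ}

theorem IsKnownFrame.coframeForm (hE : IsKnownFrame G U E) (ℓ : (Fin n → ℝ) →ₗ[ℝ] ℝ) (k : Fin n) :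
    KnownSmooth G U (fun y => coframeForm E ℓ y k) :=
  KnownSmooth.linearMap_apply hE.isOpen
    (fun j => KnownSmooth.matrix_inv hE.isOpen (fun i j => hE.known j i) hE.det_ne_zero j k) ℓ

theorem IsKnownFrame.contDiffOn_frameField (hE : IsKnownFrame G U E) (a : Fin n → ℝ) :
    ContDiffOn ℝ ∞ (frameField E a) U := by
  refine contDiffOn_pi.2 fun k => ?_
  simp only [frameField, Matrix.mulVec, dotProduct]
  exact ContDiffOn.sum fun j _ => (hE.known j k).contDiffOn.mul contDiffOn_const

theorem coframeForm_toDual (ℓ : (Fin n → ℝ) →ₗ[ℝ] ℝ) (y v : Fin n → ℝ) :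
    (coframeForm E ℓ).toDual y v = ℓ (Matrix.mulVec (frameMatrix E y)⁻¹ v) := by
  have h := pi_eq_sum_univ' v
  conv_rhs => rw [h]
  simp only [OneForm.toDual_apply, Matrix.mulVec_sum, Matrix.mulVec_smul, map_sum, map_smul,
    Matrix.mulVec_single_one, smul_eq_mul]
  exact Finset.sum_congr rfl fun k _ => mul_comm _ _

theorem IsKnownFrame.toDual_frameField (hE : IsKnownFrame G U E) (ℓ : (Fin n → ℝ) →ₗ[ℝ] ℝ)
    (a : Fin n → ℝ) {y : Fin n → ℝ} (hy : y ∈ U) :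
    (DistributionalIntegrability.coframeForm E ℓ).toDual y (frameField E a y) = ℓ a := by
  rw [coframeForm_toDual, frameField, Matrix.mulVec_mulVec,
    Matrix.nonsing_inv_mul _ (isUnit_iff_ne_zero.2 (hE.det_ne_zero y hy)), Matrix.one_mulVec]

theorem IsKnownFrame.exists_eq_frameField (hE : IsKnownFrame G U E) {y : Fin n → ℝ} (hy : y ∈ U)
    (v : Fin n → ℝ) : ∃ a, v = frameField E a y :=
  ⟨Matrix.mulVec (frameMatrix E y)⁻¹ v, by
    rw [frameField, Matrix.mulVec_mulVec,
      Matrix.mul_nonsing_inv _ (isUnit_iff_ne_zero.2 (hE.det_ne_zero y hy)), Matrix.one_mulVec]⟩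

/-- A form of the dual coframe which vanishes on the brackets of the fields tangent to the leaves
is closed on the leaves. -/
theorem IsKnownFrame.isLeafwiseClosedOn (hE : IsKnownFrame G U E) {ℓ : (Fin n → ℝ) →ₗ[ℝ] ℝ}
    {A : Submodule ℝ (Fin n → ℝ)} {Q : Fin N → (Fin n → ℝ) → ℝ} {U' : Set (Fin n → ℝ)}
    (hU' : U' ⊆ U)
    (hker : ∀ x ∈ U', ∀ a, (∀ l, fderiv ℝ (Q l) x (frameField E a x) = 0) → a ∈ A)
    (hbr : ∀ a ∈ A, ∀ b ∈ A, ∀ x ∈ U, ∃ c, ℓ c = 0 ∧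
      VectorField.lieBracket ℝ (frameField E a) (frameField E b) x = frameField E c x) :
    IsLeafwiseClosedOn Q U' (DistributionalIntegrability.coframeForm E ℓ) := by
  intro x hx u v hu hv
  have hxU := hU' hx
  set η := DistributionalIntegrability.coframeForm E ℓ with hη
  obtain ⟨a, rfl⟩ := hE.exists_eq_frameField hxU u
  obtain ⟨b, rfl⟩ := hE.exists_eq_frameField hxU v
  obtain ⟨c, hc, hbrc⟩ := hbr a (hker x hx a hu) b (hker x hx b hv) x hxU
  have hηk : ∀ k, DifferentiableAt ℝ (fun y => η y k) x := fun k =>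
    ((hE.coframeForm ℓ k).contDiffOn.contDiffAt (hE.isOpen.mem_nhds hxU)).differentiableAt (by simp)
  have hηs : ContDiffOn ℝ ∞ η.toDual U :=
    OneForm.contDiffOn_toDual fun k => (hE.coframeForm ℓ k).contDiffOn
  have hηd : HasFDerivAt η.toDual (fderiv ℝ η.toDual x) x :=
    ((hηs.contDiffAt (hE.isOpen.mem_nhds hxU)).differentiableAt (by simp)).hasFDerivAt
  -- This is the derivative of the constant function `η(X_d) = ℓ d`. Applied twice, it turns
  -- `dη(X_a, X_b)` into `-η([X_a, X_b])`.
  have hconst : ∀ d w, fderiv ℝ η.toDual x w (frameField E d x) =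
      - η.toDual x (fderiv ℝ (frameField E d) x w) := by
    intro d w
    have hXd : DifferentiableAt ℝ (frameField E d) x :=
      ((hE.contDiffOn_frameField d).contDiffAt (hE.isOpen.mem_nhds hxU)).differentiableAt (by simp)
    have h1 := hηd.clm_apply hXd.hasFDerivAt
    have h2 : HasFDerivAt (fun y => η.toDual y (frameField E d y)) 0 x :=
      (hasFDerivAt_const (𝕜 := ℝ) (ℓ d) x).congr_of_eventuallyEq (by
        filter_upwards [hE.isOpen.mem_nhds hxU] with y hy using hE.toDual_frameField ℓ d hy)
    have h3 := congrArg (fun T => T w) (h1.unique h2)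
    simp only [add_apply, ContinuousLinearMap.comp_apply, ContinuousLinearMap.flip_apply,
      zero_apply] at h3
    linarith
  rw [Finset.sum_sub_distrib, ← OneForm.fderiv_toDual_apply hηk,
    ← OneForm.fderiv_toDual_apply hηk, hconst, hconst]
  have h4 := hE.toDual_frameField ℓ c hxU
  rw [← hbrc, VectorField.lieBracket_eq, map_sub, hc] at h4
  linarith

end Frames

/-! ### One quadrature step, and the flow at the end. -/

section Quadrature

/-- The `ℓ i` are the coordinates on the image of `A` in `X ⧸ B`, extended to the whole quotient and
pulled back to `X`. Independence is asserted on `A`, because the differentials of the earlier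
potentials vanish exactly there. -/
theorem exists_dual_of_le {X : Type*} [AddCommGroup X] [Module ℝ X] [FiniteDimensional ℝ X]
    (A B : Submodule ℝ X) : ∃ (d : ℕ) (ℓ : Fin d → X →ₗ[ℝ] ℝ),
      (∀ i, ∀ z ∈ B, ℓ i z = 0) ∧ (∀ a ∈ A, (∀ i, ℓ i a = 0) → a ∈ B) ∧
      ∀ c : Fin d → ℝ, (∀ a ∈ A, ∑ i, c i * ℓ i a = 0) → ∀ i, c i = 0 := by
  set A' := A.map B.mkQ with hA'
  set b := Module.finBasis ℝ A'
  choose f hf using fun i => LinearMap.exists_extend (b.coord i)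
  have hfa : ∀ i (z : A'), f i z = b.repr z i := fun i z => congrArg (fun T => T z) (hf i)
  refine ⟨_, fun i => f i ∘ₗ B.mkQ, fun i z hz => ?_, fun a ha h => ?_, fun c hc j => ?_⟩
  · rw [LinearMap.comp_apply, Submodule.mkQ_apply, (Submodule.Quotient.mk_eq_zero B).2 hz, map_zero]
  · have h1 : (⟨B.mkQ a, Submodule.mem_map_of_mem ha⟩ : A') = 0 := by
      refine b.ext_elem fun i => ?_
      rw [← hfa, map_zero]
      exact h i
    exact (Submodule.Quotient.mk_eq_zero B).1 (congrArg Subtype.val h1)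
  · obtain ⟨a, ha, hab⟩ := (b j).2
    have := hc a ha
    simp only [LinearMap.comp_apply, hab, hfa, b.repr_self, Finsupp.single_apply] at this
    simpa using this

variable {n : ℕ}

/-- The state after some quadratures: the leaves of the known functions `Q_l` on the neighbourhood
`U` of `p` are spanned by the fields with coefficients in `A`, and the field with coefficients `c`
acts on each `Q_l` as a constant. -/
structure IsStage (G₀ : FunClass) (U₀ : Set (Fin n → ℝ)) (E : Fin n → (Fin n → ℝ) → Fin n → ℝ)
    (p c : Fin n → ℝ) (A : Submodule ℝ (Fin n → ℝ)) {N : ℕ} (Q : Fin N → (Fin n → ℝ) → ℝ)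
    (U : Set (Fin n → ℝ)) (G : FunClass) : Prop where
  isOpen : IsOpen U
  mem : p ∈ U
  subset : U ⊆ U₀
  known_of_initial : ∀ m V f, G₀ m V f → Known G m V f
  knownSmooth : ∀ l, KnownSmooth G U (Q l)
  linearIndependent : ∀ x ∈ U, LinearIndependent ℝ fun l => fderiv ℝ (Q l) x
  ker_iff : ∀ x ∈ U, ∀ a, (∀ l, fderiv ℝ (Q l) x (frameField E a x) = 0) ↔ a ∈ A
  fderiv_const : ∀ l, ∃ r : ℝ, ∀ x ∈ U, fderiv ℝ (Q l) x (frameField E c x) = r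

variable {G₀ : FunClass} {U₀ : Set (Fin n → ℝ)} {E : Fin n → (Fin n → ℝ) → Fin n → ℝ}
  {p c : Fin n → ℝ}

theorem IsStage.initial (hU₀ : IsOpen U₀) (hp : p ∈ U₀) (Q : Fin 0 → (Fin n → ℝ) → ℝ) :
    IsStage G₀ U₀ E p c ⊤ Q U₀ G₀ where
  isOpen := hU₀
  mem := hp
  subset := Subset.rfl
  known_of_initial _ _ _ h := .gen h
  knownSmooth l := l.elim0
  linearIndependent _ _ := linearIndependent_empty_type
  ker_iff _ _ _ := ⟨fun _ => trivial, fun _ l => l.elim0⟩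
  fderiv_const l := l.elim0

/-- One quadrature passes from the leaves spanned by `A` to the leaves spanned by `B`, provided
that all brackets of fields in `A` are in `B` and the distinguished field is in `A`. -/
theorem IsStage.exists_quadrature (hE : IsKnownFrame G₀ U₀ E) {A B : Submodule ℝ (Fin n → ℝ)}
    (hBA : B ≤ A) (hc : c ∈ A)
    (hbr : ∀ a ∈ A, ∀ b ∈ A, ∀ x ∈ U₀, ∃ z ∈ B,
      VectorField.lieBracket ℝ (frameField E a) (frameField E b) x = frameField E z x)
    {r N : ℕ} {Q : Fin N → (Fin n → ℝ) → ℝ} {U : Set (Fin n → ℝ)} {G : FunClass}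
    (ht : QuadratureTower G₀ U₀ r N Q U G) (hs : IsStage G₀ U₀ E p c A Q U G) :
    ∃ (N' : ℕ) (Q' : Fin N' → (Fin n → ℝ) → ℝ) (U' : Set (Fin n → ℝ)) (G' : FunClass),
      QuadratureTower G₀ U₀ (r + 1) N' Q' U' G' ∧ IsStage G₀ U₀ E p c B Q' U' G' := by
  obtain ⟨d, ℓ, hℓB, hℓA, hℓind⟩ := exists_dual_of_le A B
  obtain ⟨U', W, γ, hU', hpU', hsub, hγ, hW, hWU, hγs, hγU, hγ0⟩ :=
    exists_isLeafwisePathFamily hs.isOpen hs.mem hs.knownSmooth (hs.linearIndependent p hs.mem)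
  set η : Fin d → OneForm n := fun i => coframeForm E (ℓ i) with hη
  have hηk : ∀ i k, KnownSmooth G U (fun y => η i y k) := fun i k =>
    ((hE.coframeForm (ℓ i) k).mono_class hs.known_of_initial).mono hs.isOpen hs.subset
  have hclosed : ∀ i, IsLeafwiseClosedOn Q U (η i) := fun i =>
    hE.isLeafwiseClosedOn hs.subset (fun x hx a => (hs.ker_iff x hx a).1) fun a ha b hb x hx => by
      obtain ⟨z, hz, h⟩ := hbr a ha b hb x hx
      exact ⟨z, hℓB i z hz, h⟩
  have hpot := fun i => lineIntegral_leafwise hs.isOpen hU' hsub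
    (fun l => (hs.knownSmooth l).contDiffOn) (fun k => (hηk i k).contDiffOn) (hclosed i) hγ hW hWU
    hγs hγU hγ0
  have hpotA : ∀ i, ∀ x ∈ U', ∀ a ∈ A,
      fderiv ℝ (lineIntegral γ (η i)) x (frameField E a x) = ℓ i a := fun i x hx a ha => by
    rw [(hpot i).2 x hx _ ((hs.ker_iff x (hsub hx) a).2 ha),
      hE.toDual_frameField _ _ (hs.subset (hsub hx))]
  have hindep : ∀ x ∈ U', LinearIndependent ℝ (fun i : Fin (N + d) =>
      fderiv ℝ (Fin.append Q (fun j => lineIntegral γ (η j)) i) x) := by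
    intro x hx
    rw [Fintype.linearIndependent_iff]
    intro w hw
    simp only [Fin.sum_univ_add, Fin.append_left, Fin.append_right] at hw
    -- On fields from `A` the old differentials vanish, so a relation restricts to one among the `ℓ
    -- i`; once the new coefficients are zero, the old differentials are independent by assumption.
    have h1 : ∀ i, w (Fin.natAdd N i) = 0 := hℓind _ fun a ha => by
      have h2 := congrArg (fun T => T (frameField E a x)) hw
      simpa [hpotA _ x hx a ha, (hs.ker_iff x (hsub hx) a).2 ha] using h2
    have h2 : ∀ l, w (Fin.castAdd d l) = 0 :=
      Fintype.linearIndependent_iff.1 (hs.linearIndependent x (hsub hx)) _ (by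
        simpa [h1] using hw)
    exact Fin.addCases h2 h1
  refine ⟨_, _, _, _, ht.succ U' hU' hsub d η γ (fun i k => (hηk i k).known) hclosed hγ hindep,
    hU', hpU', hsub.trans hs.subset, fun m V f h => ?_, ?_, hindep, fun x hx a => ?_, ?_⟩
  · exact (hs.known_of_initial m V f h).mono fun _ _ _ h => .gen (.old h)
  · refine Fin.addCases (fun l => ?_) fun i => ?_
    · rw [Fin.append_left]
      exact ((hs.knownSmooth l).mono_class fun _ _ _ h => .gen (.old h)).mono hU' hsub
    · rw [Fin.append_right]
      refine ⟨?_, (hpot i).1⟩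
      have hg : ∀ x : Fin n → ℝ,
          (fun k => Fin.append x (Pi.single i (1 : ℝ)) (Fin.castAdd d k)) = x := fun x => by
        ext k; simp
      have happ : ∀ (G' : FunClass) (k : Fin (n + d)), Known G' n U'
          (fun x => Fin.append x (Pi.single i (1 : ℝ) : Fin d → ℝ) k) := fun G' =>
        Fin.addCases (fun k => by simpa only [Fin.append_left] using Known.coord hU' k)
          fun j => by simpa only [Fin.append_right] using Known.const hU' _
      -- The quadrature adds a single function of `(x, a)`; the `i`-th potential is its value at the
      -- `i`-th unit vector `a`.
      refine Known.restrict (Known.comp (g := fun x => Fin.append x (Pi.single i 1)) hU'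
        (.gen .new) (happ _) fun x hx => ?_) hU' Subset.rfl fun x hx => ?_
      · rw [mem_ofPred_eq, hg]
        exact hx
      · simp [Pi.single_apply]
  · constructor
    · intro h
      have ha : a ∈ A := (hs.ker_iff x (hsub hx) a).1 fun l => by
        simpa using h (Fin.castAdd d l)
      refine hℓA a ha fun i => ?_
      rw [← hpotA i x hx a ha]
      simpa using h (Fin.natAdd N i)
    · intro ha
      refine Fin.addCases (fun l => ?_) fun i => ?_
      · rw [Fin.append_left]
        exact (hs.ker_iff x (hsub hx) a).2 (hBA ha) l
      · rw [Fin.append_right, hpotA i x hx a (hBA ha), hℓB i a ha]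
  · refine Fin.addCases (fun l => ?_) fun i => ?_
    · rw [Fin.append_left]
      exact ⟨0, fun x hx => (hs.ker_iff x (hsub hx) c).2 hc l⟩
    · rw [Fin.append_right]
      exact ⟨ℓ i c, fun x hx => hpotA i x hx c hc⟩

/-- Once the leaves are points the flow is known. -/
theorem IsStage.exists_known_flow (hE : IsKnownFrame G₀ U₀ E) {N : ℕ}
    {Q : Fin N → (Fin n → ℝ) → ℝ} {U : Set (Fin n → ℝ)} {G : FunClass}
    (hs : IsStage G₀ U₀ E p c ⊥ Q U G) :
    ∃ (U' : Set (Fin n → ℝ)) (ε : ℝ) (Φ : (Fin (n + 1) → ℝ) → Fin n → ℝ),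
      IsOpen U' ∧ p ∈ U' ∧ U' ⊆ U ∧ 0 < ε ∧
      (∀ x ∈ U', ∀ t ∈ Ioo (-ε) ε, Φ (Fin.cons t x) ∈ U) ∧ (∀ x ∈ U', Φ (Fin.cons 0 x) = x) ∧
      (∀ x ∈ U', ∀ t ∈ Ioo (-ε) ε, HasDerivAt (fun t : ℝ => Φ (Fin.cons t x))
        (frameField E c (Φ (Fin.cons t x))) t) ∧
      ∀ i, Known G (n + 1) {z | z 0 ∈ Ioo (-ε) ε ∧ Fin.tail z ∈ U'} (fun z => Φ z i) := by
  obtain ⟨L, R, e, hLR, hL, hpe, heU, hLe, he, hek, hsymm⟩ :=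
    exists_linearizing hs.isOpen hs.mem hs.knownSmooth (hs.linearIndependent p hs.mem)
  -- The leaves are points, so `L` is injective and `R` is its inverse; the chart `e` is then just
  -- `R ∘ Q`.
  have hker : ∀ v, L v = 0 → v = 0 := fun v hv => by
    obtain ⟨a, rfl⟩ := hE.exists_eq_frameField (hs.subset hs.mem) v
    have : a ∈ (⊥ : Submodule ℝ (Fin n → ℝ)) :=
      (hs.ker_iff p hs.mem a).1 fun l => by rw [← hL, hv]; rfl
    rw [(Submodule.mem_bot ℝ).1 this, frameField, Matrix.mulVec_zero]
  have hRL : ∀ v, R (L v) = v := fun v =>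
    sub_eq_zero.1 (hker _ (by rw [map_sub, hLR, sub_self]))
  choose ρ hρ using hs.fderiv_const
  have heR : ∀ y, e y = R (fun l => Q l y) := fun y => by
    rw [he, map_sub, hRL]
    abel
  have hQd : ∀ y ∈ U, HasFDerivAt (fun y l => Q l y)
      (ContinuousLinearMap.pi fun l => fderiv ℝ (Q l) y) y := fun y hy => hasFDerivAt_pi.2 fun l =>
    (((hs.knownSmooth l).contDiffOn.contDiffAt (hs.isOpen.mem_nhds hy)).differentiableAt
      (by simp)).hasFDerivAt
  have hed : ∀ y ∈ U, HasFDerivAt e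
      (R.comp (ContinuousLinearMap.pi fun l => fderiv ℝ (Q l) y)) y := fun y hy => by
    have h1 : ⇑e = fun y => R (fun l => Q l y) := funext heR
    rw [h1]
    exact R.hasFDerivAt.comp y (hQd y hy)
  -- The field acts on `Q` as the constant vector `ρ`, so in the coordinates `e` its flow is
  -- translation by `t • R ρ`.
  set h : (Fin (n + 1) → ℝ) → Fin n → ℝ := fun z => e (Fin.tail z) + z 0 • R ρ with hh
  set W₀ : Set (Fin (n + 1) → ℝ) := Fin.tail ⁻¹' e.source with hW₀
  have hW₀o : IsOpen W₀ := e.open_source.preimage continuous_tail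
  have hhk : ∀ k, KnownSmooth G W₀ (fun z => h z k) := fun k =>
    ((hek k).comp hW₀o (fun i => .coord hW₀o _) fun z hz => hz).add
      ((KnownSmooth.coord hW₀o 0).mul (.const hW₀o (R ρ k)))
  have hhs : ContDiffOn ℝ ∞ h W₀ := contDiffOn_pi.2 fun k => (hhk k).contDiffOn
  have hWo : IsOpen (W₀ ∩ h ⁻¹' e.target) :=
    hhs.continuousOn.isOpen_inter_preimage hW₀o e.open_target
  obtain ⟨u, v, hu, hv, hu0, hpv, huv⟩ := exists_box_subset (isCompact_singleton (x := (0 : ℝ)))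
    hWo (p := p) (fun t ht => by
      rw [mem_singleton_iff] at ht
      subst ht
      refine ⟨hpe, ?_⟩
      simp only [hh, mem_preimage, Fin.tail_cons, Fin.cons_zero, zero_smul, add_zero]
      exact e.map_source hpe)
  obtain ⟨ε, hε, hεu⟩ := Metric.isOpen_iff.1 hu 0 (hu0 rfl)
  rw [Real.ball_eq_Ioo, zero_sub, zero_add] at hεu
  have hW : ∀ x ∈ v, ∀ t ∈ Ioo (-ε) ε, (Fin.cons t x : Fin (n + 1) → ℝ) ∈ W₀ ∩ h ⁻¹' e.target :=
    fun x hx t ht => huv t (hεu ht) x hx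
  have hve : v ⊆ e.source := fun x hx => (hW x hx 0 ⟨neg_lt_zero.2 hε, hε⟩).1
  have hDo : IsOpen {z : Fin (n + 1) → ℝ | z 0 ∈ Ioo (-ε) ε ∧ Fin.tail z ∈ v} :=
    (isOpen_Ioo.preimage (continuous_apply 0)).inter (hv.preimage continuous_tail)
  have hDW : {z : Fin (n + 1) → ℝ | z 0 ∈ Ioo (-ε) ε ∧ Fin.tail z ∈ v} ⊆ W₀ ∩ h ⁻¹' e.target := by
    intro z hz
    rw [← Fin.cons_self_tail z]
    exact hW _ hz.2 _ hz.1
  refine ⟨v, ε, fun z => e.symm (h z), hv, hpv, hve.trans heU, hε,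
    fun x hx t ht => heU (e.map_target (hW x hx t ht).2), fun x hx => ?_, fun x hx t ht => ?_,
    fun i => ?_⟩
  · simp only [hh, Fin.tail_cons, Fin.cons_zero, zero_smul, add_zero]
    exact e.left_inv (hve hx)
  · have hz := (hW x hx t ht).2
    have hyU : e.symm (h (Fin.cons t x)) ∈ U := heU (e.map_target hz)
    have h1 : HasDerivAt (fun t : ℝ => h (Fin.cons t x)) (R ρ) t := by
      simp only [hh, Fin.tail_cons, Fin.cons_zero]
      simpa using ((hasDerivAt_id t).smul_const (R ρ)).const_add (e x)
    have h2 : HasFDerivAt e.symm (fderiv ℝ e.symm (h (Fin.cons t x))) (h (Fin.cons t x)) :=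
      (((contDiffOn_pi.2 fun k => (hsymm k).contDiffOn).contDiffAt
        (e.open_target.mem_nhds hz)).differentiableAt (by simp : (∞ : WithTop ℕ∞) ≠ 0)).hasFDerivAt
    have h3 := h2.comp_hasDerivAt t h1
    refine h3.congr_deriv (sub_eq_zero.1 (hker _ ?_))
    have h4 : HasFDerivAt (e ∘ e.symm) (ContinuousLinearMap.id ℝ _) (h (Fin.cons t x)) :=
      (hasFDerivAt_id _).congr_of_eventuallyEq (by
        filter_upwards [e.open_target.mem_nhds hz] with y hy using e.right_inv hy)
    have h5 := congrArg (fun T => L (T (R ρ))) (((hed _ hyU).comp _ h2).unique h4)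
    have h6 : L (R ((ContinuousLinearMap.pi fun l => fderiv ℝ (Q l) (e.symm (h (Fin.cons t x))))
        (frameField E c (e.symm (h (Fin.cons t x)))))) = ρ := by
      rw [hLR]
      exact funext fun l => hρ l _ hyU
    simp only [ContinuousLinearMap.comp_apply, hLR, ContinuousLinearMap.id_apply] at h5 h6
    -- The velocity of the curve and the field have the same image `ρ` under all `dQ_l`. Their
    -- difference is tangent to a leaf, so its frame coefficients lie in `⊥`.
    have h7 := hE.exists_eq_frameField (hs.subset hyU)
      (fderiv ℝ e.symm (h (Fin.cons t x)) (R ρ) - frameField E c (e.symm (h (Fin.cons t x))))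
    obtain ⟨a, ha⟩ := h7
    have h8 : a ∈ (⊥ : Submodule ℝ (Fin n → ℝ)) := (hs.ker_iff _ hyU a).1 fun l => by
      rw [← ha, map_sub]
      exact sub_eq_zero.2 (congrFun (h5.trans h6.symm) l)
    rw [ha, (Submodule.mem_bot ℝ).1 h8, frameField, Matrix.mulVec_zero, map_zero]
  · exact ((hsymm i).comp hDo (fun k => (hhk k).mono hDo fun z hz => (hDW hz).1)
      fun z hz => (hDW hz).2).known

end Quadrature

/-! ### Vector fields, brackets and integral curves in a chart. -/

section Charts

variable {n : ℕ} {M : Type*} [TopologicalSpace M] [ChartedSpace (Fin n → ℝ) M]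
  {φ : OpenPartialHomeomorph M (Fin n → ℝ)}

theorem chartField_add (X Y : (x : M) → TangentSpace 𝓘(ℝ, Fin n → ℝ) x) (y : Fin n → ℝ) :
    chartField φ (X + Y) y = chartField φ X y + chartField φ Y y :=
  map_add (mfderiv 𝓘(ℝ, Fin n → ℝ) 𝓘(ℝ, Fin n → ℝ) φ (φ.symm y)) _ _

theorem chartField_smul (c : ℝ) (X : (x : M) → TangentSpace 𝓘(ℝ, Fin n → ℝ) x) (y : Fin n → ℝ) :
    chartField φ (c • X) y = c • chartField φ X y :=
  map_smul (mfderiv 𝓘(ℝ, Fin n → ℝ) 𝓘(ℝ, Fin n → ℝ) φ (φ.symm y)) _ _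

/-- `X ↦ chartField φ X y`, as a linear map. -/
noncomputable def chartFieldLinear (φ : OpenPartialHomeomorph M (Fin n → ℝ)) (y : Fin n → ℝ) :
    ((x : M) → TangentSpace 𝓘(ℝ, Fin n → ℝ) x) →ₗ[ℝ] (Fin n → ℝ) where
  toFun X := chartField φ X y
  map_add' X Y := chartField_add X Y y
  map_smul' c X := chartField_smul c X y

theorem mdifferentiable_of_mem_maximalAtlas (hφ : φ ∈ IsManifold.maximalAtlas 𝓘(ℝ, Fin n → ℝ) ∞ M) :
    φ.MDifferentiable 𝓘(ℝ, Fin n → ℝ) 𝓘(ℝ, Fin n → ℝ) :=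
  ⟨(contMDiffOn_of_mem_maximalAtlas hφ).mdifferentiableOn (by simp),
    (contMDiffOn_symm_of_mem_maximalAtlas hφ).mdifferentiableOn (by simp)⟩

/-- Pushing forward by `φ` is pulling back by `φ.symm`; in this form smoothness and the naturality
of the bracket carry over to `chartField`. -/
theorem chartField_eq_mpullback (hφ : φ ∈ IsManifold.maximalAtlas 𝓘(ℝ, Fin n → ℝ) ∞ M)
    (X : (x : M) → TangentSpace 𝓘(ℝ, Fin n → ℝ) x) {y : Fin n → ℝ} (hy : y ∈ φ.target) :
    chartField φ X y =
      VectorField.mpullback 𝓘(ℝ, Fin n → ℝ) 𝓘(ℝ, Fin n → ℝ) φ.symm X y := by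
  have hd := mdifferentiable_of_mem_maximalAtlas hφ
  have hinv : (mfderiv 𝓘(ℝ, Fin n → ℝ) 𝓘(ℝ, Fin n → ℝ) φ.symm y).inverse =
      mfderiv 𝓘(ℝ, Fin n → ℝ) 𝓘(ℝ, Fin n → ℝ) φ (φ.symm y) := by
    refine ContinuousLinearMap.inverse_eq ?_ (hd.comp_symm_deriv hy)
    have := hd.symm_comp_deriv (φ.map_target hy)
    rwa [φ.right_inv hy] at this
  exact (congrArg (fun T => T (X (φ.symm y))) hinv).symm

theorem mfderiv_symm_chartField (hφ : φ ∈ IsManifold.maximalAtlas 𝓘(ℝ, Fin n → ℝ) ∞ M)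
    (X : (x : M) → TangentSpace 𝓘(ℝ, Fin n → ℝ) x) {y : Fin n → ℝ} (hy : y ∈ φ.target) :
    mfderiv 𝓘(ℝ, Fin n → ℝ) 𝓘(ℝ, Fin n → ℝ) φ.symm y (chartField φ X y) = X (φ.symm y) := by
  have := (mdifferentiable_of_mem_maximalAtlas hφ).symm_comp_deriv (φ.map_target hy)
  rw [φ.right_inv hy] at this
  exact congrArg (fun T => T (X (φ.symm y))) this

theorem isInvertible_mfderiv_symm (hφ : φ ∈ IsManifold.maximalAtlas 𝓘(ℝ, Fin n → ℝ) ∞ M)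
    {y : Fin n → ℝ} (hy : y ∈ φ.target) :
    (mfderiv 𝓘(ℝ, Fin n → ℝ) 𝓘(ℝ, Fin n → ℝ) φ.symm y).IsInvertible :=
  ⟨(mdifferentiable_of_mem_maximalAtlas hφ).symm.mfderiv hy, rfl⟩

/-- A curve which solves the differential equation of `X` in a chart is an integral curve. -/
theorem isMIntegralCurveOn_of_hasDerivAt
    (hφ : φ ∈ IsManifold.maximalAtlas 𝓘(ℝ, Fin n → ℝ) ∞ M)
    {X : (x : M) → TangentSpace 𝓘(ℝ, Fin n → ℝ) x} {c : ℝ → Fin n → ℝ} {s : Set ℝ}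
    (hc : ∀ t ∈ s, c t ∈ φ.target) (hd : ∀ t ∈ s, HasDerivAt c (chartField φ X (c t)) t) :
    IsMIntegralCurveOn (fun t => φ.symm (c t)) X s := by
  intro t ht
  have h1 : HasMFDerivAt 𝓘(ℝ, Fin n → ℝ) 𝓘(ℝ, Fin n → ℝ) φ.symm (c t)
      (mfderiv 𝓘(ℝ, Fin n → ℝ) 𝓘(ℝ, Fin n → ℝ) φ.symm (c t)) :=
    ((mdifferentiable_of_mem_maximalAtlas hφ).mdifferentiableAt_symm (hc t ht)).hasMFDerivAt
  have h2 := (h1.comp t (hd t ht).hasFDerivAt.hasMFDerivAt).hasMFDerivWithinAt (s := s)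
  refine h2.congr_mfderiv (ContinuousLinearMap.ext_ring ?_)
  have h3 := mfderiv_symm_chartField hφ X (hc t ht)
  exact (congrArg (mfderiv 𝓘(ℝ, Fin n → ℝ) 𝓘(ℝ, Fin n → ℝ) φ.symm (c t)) (one_smul ℝ _)).trans
    (h3.trans (one_smul ℝ _).symm)

variable [IsManifold 𝓘(ℝ, Fin n → ℝ) ∞ M]

theorem contDiffOn_chartField (hφ : φ ∈ IsManifold.maximalAtlas 𝓘(ℝ, Fin n → ℝ) ∞ M)
    {X : (x : M) → TangentSpace 𝓘(ℝ, Fin n → ℝ) x} (hX : IsSmoothField X) :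
    ContDiffOn ℝ ∞ (chartField φ X) φ.target := by
  intro y hy
  have h1 := ContMDiffAt.mpullback_vectorField_preimage (m := ∞) (n := ∞) (hX (φ.symm y))
    (contMDiffAt_symm_of_mem_maximalAtlas hφ hy) (isInvertible_mfderiv_symm hφ hy) (by simp)
  have h2 := contMDiffAt_vectorSpace_iff_contDiffAt.1 h1
  refine (h2.congr_of_eventuallyEq ?_).contDiffWithinAt
  filter_upwards [φ.open_target.mem_nhds hy] with z hz using chartField_eq_mpullback hφ X hz

theorem lieBracket_chartField (hφ : φ ∈ IsManifold.maximalAtlas 𝓘(ℝ, Fin n → ℝ) ∞ M)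
    {X Y : (x : M) → TangentSpace 𝓘(ℝ, Fin n → ℝ) x} (hX : IsSmoothField X) (hY : IsSmoothField Y)
    {y : Fin n → ℝ} (hy : y ∈ φ.target) :
    VectorField.lieBracket ℝ (chartField φ X) (chartField φ Y) y =
      chartField φ (VectorField.mlieBracket 𝓘(ℝ, Fin n → ℝ) X Y) y := by
  have hmin : minSmoothness ℝ 2 ≤ (∞ : WithTop ℕ∞) := by
    rw [minSmoothness_of_isRCLikeNormedField]
    exact WithTop.coe_le_coe.2 (le_top : (2 : ℕ∞) ≤ ⊤)
  have : IsManifold 𝓘(ℝ, Fin n → ℝ) (minSmoothness ℝ 2) M := .of_le hmin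
  have heq : ∀ X, chartField φ X =ᶠ[nhds y]
      VectorField.mpullback 𝓘(ℝ, Fin n → ℝ) 𝓘(ℝ, Fin n → ℝ) φ.symm X := fun X => by
    filter_upwards [φ.open_target.mem_nhds hy] with z hz using chartField_eq_mpullback hφ X hz
  rw [(heq X).lieBracket_vectorField_eq (heq Y), chartField_eq_mpullback hφ _ hy,
    VectorField.mpullback_mlieBracket ((hX _).mdifferentiableAt (by simp))
      ((hY _).mdifferentiableAt (by simp)) (contMDiffAt_symm_of_mem_maximalAtlas hφ hy) hmin,
    ← VectorField.mlieBracketWithin_univ, VectorField.mlieBracketWithin_eq_lieBracketWithin]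
  exact (congrFun VectorField.lieBracketWithin_univ y).symm

end Charts

/-! ### The series of `Γ` and the chain of quadratures. -/

section Series

variable {n : ℕ} {M : Type*} [TopologicalSpace M] [ChartedSpace (Fin n → ℝ) M]
  {V : Submodule ℝ ((x : M) → TangentSpace 𝓘(ℝ, Fin n → ℝ) x)}

/-- The intersection of `V` with the first terms of the series. -/
noncomputable def partialSeries (V : Submodule ℝ ((x : M) → TangentSpace 𝓘(ℝ, Fin n → ℝ) x))
    (Γ : (x : M) → TangentSpace 𝓘(ℝ, Fin n → ℝ) x) (m : ℕ) :
    Submodule ℝ ((x : M) → TangentSpace 𝓘(ℝ, Fin n → ℝ) x) :=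
  ⨅ j : Fin (m + 1), series V Γ j

theorem mem_partialSeries {Γ X : (x : M) → TangentSpace 𝓘(ℝ, Fin n → ℝ) x} {m : ℕ} :
    X ∈ partialSeries V Γ m ↔ ∀ j ≤ m, X ∈ series V Γ j := by
  simp only [partialSeries, Submodule.mem_iInf, Fin.forall_iff, Nat.lt_succ_iff]

/-- Intersecting makes the chain decrease by construction, as the inclusion `B ≤ A` in
`IsStage.exists_quadrature` requires. -/
theorem partialSeries_antitone (Γ : (x : M) → TangentSpace 𝓘(ℝ, Fin n → ℝ) x) :
    Antitone (partialSeries V Γ) := fun _ _ hml _ hX =>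
  mem_partialSeries.2 fun j hj => mem_partialSeries.1 hX j (hj.trans hml)

theorem self_mem_partialSeries {Γ : (x : M) → TangentSpace 𝓘(ℝ, Fin n → ℝ) x} (hΓ : Γ ∈ V) (m : ℕ) :
    Γ ∈ partialSeries V Γ m :=
  mem_partialSeries.2 fun j _ => by
    cases j with
    | zero => exact hΓ
    | succ j => exact Submodule.mem_sup_left (Submodule.mem_span_singleton_self Γ)

/-- The components of the elements of a basis of `V` in a chart. -/
noncomputable def chartFrame (φ : OpenPartialHomeomorph M (Fin n → ℝ)) (b : Module.Basis (Fin n) ℝ V) :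
    Fin n → (Fin n → ℝ) → Fin n → ℝ :=
  fun j => chartField φ (b j : (x : M) → TangentSpace 𝓘(ℝ, Fin n → ℝ) x)

theorem frameField_chartFrame (φ : OpenPartialHomeomorph M (Fin n → ℝ))
    (b : Module.Basis (Fin n) ℝ V) (a : Fin n → ℝ) :
    frameField (chartFrame φ b) a =
      chartField φ (b.equivFun.symm a : (x : M) → TangentSpace 𝓘(ℝ, Fin n → ℝ) x) := by
  ext y k
  have h : chartField φ (b.equivFun.symm a : (x : M) → TangentSpace 𝓘(ℝ, Fin n → ℝ) x) y =
      ∑ j, a j • chartFrame φ b j y := by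
    change chartFieldLinear φ y (V.subtype (b.equivFun.symm a)) = _
    rw [Module.Basis.equivFun_symm_apply, map_sum, map_sum]
    simp only [map_smul]
    rfl
  rw [h]
  simp [frameField, frameMatrix, Matrix.mulVec, dotProduct, mul_comm]

variable [IsManifold 𝓘(ℝ, Fin n → ℝ) ∞ M]

/-- Each value of an element of `S` is the value of an element of `V` which is in `core V S`. -/
theorem IsCompletelyRegular.mem_core (hV : IsCompletelyRegular V)
    {S : Set ((x : M) → TangentSpace 𝓘(ℝ, Fin n → ℝ) x)}
    {Z X : (x : M) → TangentSpace 𝓘(ℝ, Fin n → ℝ) x} (hZ : Z ∈ S) (hX : X ∈ V) {p : M}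
    (hXZ : X p = Z p) : X ∈ core V S := by
  refine (Submodule.mem_sInf).2 fun W hW => ?_
  obtain ⟨hWV, hSW⟩ := hW
  obtain ⟨k, f, Y, hY, hZf⟩ := hSW hZ
  -- Freezing the coefficient functions at `p` gives an element of `W` with the same value as `X` at
  -- `p`, hence equal to `X` by injectivity of evaluation on `V`.
  have h1 : ∑ i, f i p • Y i ∈ W := W.sum_mem fun i _ => W.smul_mem _ (hY i)
  have h2 : (⟨X, hX⟩ : V) = ⟨∑ i, f i p • Y i, hWV h1⟩ := (hV.bijective_eval p).1 (by
    simp only [hXZ, hZf p, Finset.sum_apply, Pi.smul_apply])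
  have h3 : X = ∑ i, f i p • Y i := congrArg Subtype.val h2
  exact h3 ▸ h1

/-- Brackets of elements of one term of the series take their values in the next term. -/
theorem IsCompletelyRegular.exists_eq_mlieBracket (hV : IsCompletelyRegular V)
    {Γ X Y : (x : M) → TangentSpace 𝓘(ℝ, Fin n → ℝ) x} {m : ℕ} (hX : X ∈ partialSeries V Γ m)
    (hY : Y ∈ partialSeries V Γ m) (p : M) :
    ∃ Z ∈ partialSeries V Γ (m + 1), Z p = VectorField.mlieBracket 𝓘(ℝ, Fin n → ℝ) X Y p := by
  -- `Z` may depend on `p`. The same `Z` lies in every term up to `m + 1`, since `mem_core` applies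
  -- to each of them.
  obtain ⟨⟨Z, hZV⟩, hZ⟩ :=
    (hV.bijective_eval p).2 (VectorField.mlieBracket 𝓘(ℝ, Fin n → ℝ) X Y p)
  refine ⟨Z, mem_partialSeries.2 fun j hj => ?_, hZ⟩
  cases j with
  | zero => exact hZV
  | succ j =>
    have hj' : j ≤ m := Nat.le_of_succ_le_succ hj
    exact Submodule.mem_sup_right (hV.mem_core
      ⟨X, mem_partialSeries.1 hX j hj', Y, mem_partialSeries.1 hY j hj', rfl⟩ hZV hZ)

/-- Evaluation at `p`, as a linear equivalence of `V` onto the tangent space. -/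
noncomputable def IsCompletelyRegular.evalEquiv (hV : IsCompletelyRegular V) (p : M) :
    V ≃ₗ[ℝ] (Fin n → ℝ) :=
  LinearEquiv.ofBijective
    ({ toFun := fun X => (X : (x : M) → TangentSpace 𝓘(ℝ, Fin n → ℝ) x) p
       map_add' := fun _ _ => rfl
       map_smul' := fun _ _ => rfl } : V →ₗ[ℝ] (Fin n → ℝ)) (hV.bijective_eval p)

theorem IsCompletelyRegular.isKnownFrame (hV : IsCompletelyRegular V)
    {φ : OpenPartialHomeomorph M (Fin n → ℝ)}
    (hφ : φ ∈ IsManifold.maximalAtlas 𝓘(ℝ, Fin n → ℝ) ∞ M) (b : Module.Basis (Fin n) ℝ V) :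
    IsKnownFrame (chartData φ V) φ.target (chartFrame φ b) where
  isOpen := φ.open_target
  known j k := ⟨.gen (.mk _ (b j).2 k),
    contDiffOn_pi.1 (contDiffOn_chartField hφ (hV.smooth _ (b j).2)) k⟩
  det_ne_zero y hy := by
    intro hdet
    obtain ⟨a, ha, h0⟩ := Matrix.exists_mulVec_eq_zero_iff.2 hdet
    refine ha ?_
    have h1 : chartField φ (b.equivFun.symm a : (x : M) → TangentSpace 𝓘(ℝ, Fin n → ℝ) x) y = 0 := by
      rw [← frameField_chartFrame]
      exact h0
    have h2 := mfderiv_symm_chartField hφ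
      (b.equivFun.symm a : (x : M) → TangentSpace 𝓘(ℝ, Fin n → ℝ) x) hy
    rw [h1] at h2
    have h3 : hV.evalEquiv (φ.symm y) (b.equivFun.symm a) = 0 :=
      h2.symm.trans (map_zero (mfderiv 𝓘(ℝ, Fin n → ℝ) 𝓘(ℝ, Fin n → ℝ) φ.symm y))
    exact b.equivFun.symm.map_eq_zero_iff.1 ((hV.evalEquiv _).map_eq_zero_iff.1 h3)

theorem IsCompletelyRegular.isIntegrableByQuadratures (hV : IsCompletelyRegular V)
    {Γ : (x : M) → TangentSpace 𝓘(ℝ, Fin n → ℝ) x} (hΓ : Γ ∈ V) {k : ℕ}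
    (hk : IsAbelianSpace (series V Γ k)) : IsIntegrableByQuadratures V Γ (k + 1) := by
  intro φ hφ p hp
  set b : Module.Basis (Fin n) ℝ V := .ofEquivFun (hV.evalEquiv p)
  have hE := hV.isKnownFrame hφ b
  set E := chartFrame φ b with hEdef
  set c : Fin n → ℝ := b.equivFun ⟨Γ, hΓ⟩ with hc
  have hcE : frameField E c = chartField φ Γ := by
    rw [hEdef, frameField_chartFrame, hc, LinearEquiv.symm_apply_apply]
  set A : ℕ → Submodule ℝ (Fin n → ℝ) := fun m =>
    (partialSeries V Γ m).comap (V.subtype ∘ₗ (b.equivFun.symm : (Fin n → ℝ) →ₗ[ℝ] V)) with hA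
  have hmemA : ∀ m a, a ∈ A m ↔
      (b.equivFun.symm a : (x : M) → TangentSpace 𝓘(ℝ, Fin n → ℝ) x) ∈ partialSeries V Γ m :=
    fun _ _ => Iff.rfl
  have hcA : ∀ m, c ∈ A m := fun m => by
    rw [hmemA, hc, LinearEquiv.symm_apply_apply]
    exact self_mem_partialSeries hΓ m
  have hbracket : ∀ a a' : Fin n → ℝ, ∀ x ∈ φ.target,
      VectorField.lieBracket ℝ (frameField E a) (frameField E a') x =
        chartField φ (VectorField.mlieBracket 𝓘(ℝ, Fin n → ℝ) (b.equivFun.symm a)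
          (b.equivFun.symm a')) x := fun a a' x hx => by
    rw [hEdef, frameField_chartFrame, frameField_chartFrame]
    exact lieBracket_chartField hφ (hV.smooth _ (b.equivFun.symm a).2)
      (hV.smooth _ (b.equivFun.symm a').2) hx
  have hstage : ∀ m, ∃ (N : ℕ) (Q : Fin N → (Fin n → ℝ) → ℝ) (U : Set (Fin n → ℝ)) (G : FunClass),
      QuadratureTower (chartData φ V) φ.target m N Q U G ∧
        IsStage (chartData φ V) φ.target E (φ p) c (A m) Q U G := by
    intro m
    induction m with
    | zero =>
      have h0 : A 0 = ⊤ := eq_top_iff.2 fun a _ => mem_partialSeries.2 fun j hj => by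
        rw [Nat.le_zero.1 hj]
        exact (b.equivFun.symm a).2
      rw [h0]
      exact ⟨0, Fin.elim0, _, _, .zero _, .initial φ.open_target (φ.map_source hp) _⟩
    | succ m ih =>
      obtain ⟨N, Q, U, G, ht, hs⟩ := ih
      refine hs.exists_quadrature hE (fun a ha => partialSeries_antitone Γ m.le_succ ha) (hcA m)
        (fun a ha a' ha' x hx => ?_) ht
      obtain ⟨Z, hZ, hZx⟩ := hV.exists_eq_mlieBracket ha ha' (φ.symm x)
      have hZV : Z ∈ V := mem_partialSeries.1 hZ 0 (Nat.zero_le _)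
      refine ⟨b.equivFun ⟨Z, hZV⟩, ?_, ?_⟩
      · rw [hmemA, LinearEquiv.symm_apply_apply]
        exact hZ
      · rw [hbracket a a' x hx, hEdef, frameField_chartFrame, LinearEquiv.symm_apply_apply]
        exact congrArg (mfderiv 𝓘(ℝ, Fin n → ℝ) 𝓘(ℝ, Fin n → ℝ) φ (φ.symm x)) hZx.symm
  obtain ⟨N, Q, U, G, ht, hs⟩ := hstage k
  -- All brackets of fields from `A k` vanish, so the `k + 1`-st quadrature can go straight to the
  -- zero space, whatever `A (k + 1)` is; `Γ` need only lie in the source `A k`.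
  obtain ⟨N', Q', U', G', ht', hs'⟩ := hs.exists_quadrature hE (B := ⊥) bot_le (hcA k)
    (fun a ha a' ha' x hx => ⟨0, Submodule.zero_mem _, by
      rw [hbracket a a' x hx, frameField, Matrix.mulVec_zero]
      refine (congrArg (mfderiv 𝓘(ℝ, Fin n → ℝ) 𝓘(ℝ, Fin n → ℝ) φ (φ.symm x)) ?_).trans
        (map_zero (mfderiv 𝓘(ℝ, Fin n → ℝ) 𝓘(ℝ, Fin n → ℝ) φ (φ.symm x)))
      exact hk _ (mem_partialSeries.1 ha k le_rfl) _ (mem_partialSeries.1 ha' k le_rfl) _⟩) ht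
  obtain ⟨U'', ε, Φ, hU'', hpU, hsub, hε, hmem, hinit, hder, hknown⟩ := hs'.exists_known_flow hE
  refine ⟨N', Q', U', G', ht', U'', ε, Φ, hU'', hpU, hsub, hε,
    ⟨fun x hx t ht => hs'.subset (hmem x hx t ht), hinit, fun x hx => ?_⟩, hknown⟩
  exact isMIntegralCurveOn_of_hasDerivAt hφ (fun t ht => hs'.subset (hmem x hx t ht))
    fun t ht => hcE ▸ hder x hx t ht

end Series

end DistributionalIntegrability

theorem mainTheorem1 {n : ℕ} {M : Type*} [TopologicalSpace M] [ChartedSpace (Fin n → ℝ) M]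
    [IsManifold 𝓘(ℝ, Fin n → ℝ) ∞ M]
    (V : Submodule ℝ ((x : M) → TangentSpace 𝓘(ℝ, Fin n → ℝ) x))
    (hV : DistributionalIntegrability.IsCompletelyRegular V)
    (Γ : (x : M) → TangentSpace 𝓘(ℝ, Fin n → ℝ) x) (hΓ : Γ ∈ V) (r : ℕ)
    (h : DistributionalIntegrability.IsDistributionallyIntegrable V Γ r) :
    DistributionalIntegrability.IsIntegrableByQuadratures V Γ r := by
  obtain ⟨k, rfl, hk, -⟩ := h
  exact hV.isIntegrableByQuadratures hΓ hk
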